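/- Let $n\ge 1$ and let $W$ be a compact, simply connected (in particular path-connected), Hausdorff $2n$-dimensional topological manifold with boundary, together with a homeomorphism $h\colon S^{2n-1}\to\partial W$. For $\epsilon>0$ let $W_\epsilon=W\cup_h (S^{2n-1}\times(-\epsilon,0])$, where $h(s)\in\partial W$ is identified with $(s,0)$. For $N\ge 2n+1$ write $\mathbb R^N=\mathbb R^{N-1}\times\mathbb R$ and let $\mathrm{std}\colon S^{2n-1}\times(-\epsilon,0]\to\mathbb R^{2n}\times(-\infty,0]\subset\mathbb R^{N-1}\times\mathbb R$ be the standard inclusion. A $k$-simplex of the simplicial set $\mathrm{Emb}^{\mathrm{lf}}_\epsilon(W,\mathbb R^N)$ is a map $e\colon\Delta^k\times W_\epsilon\to\Delta^k\times\mathbb R^{N-1}\times\mathbb R$ over $\Delta^k$ such that - $e$ is a locally flat embedding over $\Delta^k$: it is a homeomorphism onto its image, and every $(t,x)\in\Delta^k\times W_\epsilon$ has open neighbourhoods $t\in U\subset\Delta^k$, $x\in V\subset W_\epsilon$ and a map $U\times V\times\mathbb R^{N-2n}\to\Delta^k\times\mathbb R^N$ over $\Delta^k$ that is a homeomorphism onto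 its image and restricts to $e$ on $U\times V\times\{0\}$; - $e=\mathrm{id}\times\mathrm{std}$ on $\Delta^k\times S^{2n-1}\times(-\epsilon,0]$; - $e^{-1}(\Delta^k\times\mathbb R^{N-1}\times(-\infty,0])=\Delta^k\times S^{2n-1}\times(-\epsilon,0]$. Let $\mathrm{Emb}^{\mathrm{lf}}_\partial(W,\mathbb R^\infty)=\operatorname{colim}_{N\to\infty}\operatorname{colim}_{\epsilon\to0}\mathrm{Emb}^{\mathrm{lf}}_\epsilon(W,\mathbb R^N)$, where $\mathbb R^{N-1}\times\mathbb R\hookrightarrow\mathbb R^{N}\times\mathbb R$ is standard on the first factor and the identity on the second. Let $\mathrm{Top}_\partial(W)$ be the simplicial group whose $k$-simplices are the homeomorphisms of $\Delta^k\times W$ over $\Delta^k$ that are the identity on $\Delta^k\times\partial W$. It acts on $\mathrm{Emb}^{\mathrm{lf}}_\partial(W,\mathbb R^\infty)$ by $\varphi\cdot e=e\circ\varphi^{-1}$, where $\varphi$ is extended by the identity over the collar. For a simplicial group $G$ let $EG$ be the simplicial set with $(EG)_k=G_k^{k+1}$ (the diagonal of the levelwise homogeneous bar construction), with $G$ acting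 by left multiplication, and let $BG=EG/G$. Then: 1. $\mathrm{Emb}^{\mathrm{lf}}_\partial(W,\mathbb R^\infty)$ is weakly contractible: its geometric realization is non-empty and all its homotopy groups (and $\pi_0$) are trivial. 2. The quotient $\mathrm{Emb}^{\mathrm{lf}}_\partial(W,\mathbb R^\infty)/\mathrm{Top}_\partial(W)$ is a classifying space for $\mathrm{Top}_\partial(W)$: the action is free in every simplicial degree, and there is a $\mathrm{Top}_\partial(W)$-equivariant map $\mathrm{Emb}^{\mathrm{lf}}_\partial(W,\mathbb R^\infty)\to E\mathrm{Top}_\partial(W)$ whose induced map of quotients $\mathrm{Emb}^{\mathrm{lf}}_\partial(W,\mathbb R^\infty)/\mathrm{Top}_\partial(W)\to B\mathrm{Top}_\partial(W)$ realizes to a homotopy equivalence. -/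

import Mathlib

open CategoryTheory Opposite Simplicial Topology

universe u

noncomputable section

namespace LFEmb

/-! ### Locally flat embeddings over a base -/

section LocallyFlat

variable {B B' M M' N : Type*} [TopologicalSpace B] [TopologicalSpace B'] [TopologicalSpace M]
  [TopologicalSpace M'] [TopologicalSpace N]

/-- A map `B × M → B × N` over `B` is recorded by its second component `g : B × M → N`; the map
itself is `(b, m) ↦ (b, g (b, m))`. The predicate says that it is a locally flat embedding over `B`
of codimension `c`: it is a homeomorphism onto its image, and each `(b, m)` has a product
neighbourhood `U × V` with a map `U × V × ℝᶜ → B × N` over `B` which is a homeomorphism onto its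
image and restricts to the given map on `U × V × {0}`. -/
structure IsLocallyFlatEmbeddingOver (c : ℕ) (g : B × M → N) : Prop where
  isEmbedding : IsEmbedding (fun p : B × M => (p.1, g p))
  flat : ∀ (b : B) (m : M), ∃ (U : Set B) (V : Set M),
    IsOpen U ∧ b ∈ U ∧ IsOpen V ∧ m ∈ V ∧
    ∃ F : (U × V) × (Fin c → ℝ) → N,
      IsEmbedding (fun p : (U × V) × (Fin c → ℝ) => ((p.1.1 : B), F p)) ∧
      ∀ (x : U) (v : V), F ((x, v), 0) = g (x, v)

theorem isEmbedding_of_leftInverse {X Y : Type*} [TopologicalSpace X] [TopologicalSpace Y]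
    {f : X → Y} {r : Y → X} (hf : Continuous f) (hr : Continuous r) (h : ∀ x, r (f x) = x) :
    IsEmbedding f := by
  refine IsEmbedding.of_comp hf hr ?_
  have : r ∘ f = id := funext h
  rw [this]; exact IsEmbedding.id

/-- Local flatness is preserved by base change along `α` and by precomposition with embeddings
over the base. -/
theorem IsLocallyFlatEmbeddingOver.precomp {c : ℕ} {g : B × M → N}
    (hg : IsLocallyFlatEmbeddingOver c g) (α : B' → B) (hα : Continuous α)
    (E : B' × M' → M) (hE : IsEmbedding (fun p : B' × M' => (p.1, E p))) :
    IsLocallyFlatEmbeddingOver c (fun p : B' × M' => g (α p.1, E p)) := by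
  have hEc : Continuous E := continuous_snd.comp hE.continuous
  have hgc : Continuous g := continuous_snd.comp hg.isEmbedding.continuous
  refine ⟨?_, fun b m => ?_⟩
  · refine IsEmbedding.of_comp (g := fun q : B' × N => (q.1, (α q.1, q.2)))
      (by fun_prop) (by fun_prop) ?_
    have h1 : IsEmbedding (fun p : B' × M' => (p.1, (α p.1, E p))) := by
      refine IsEmbedding.of_comp (g := fun q : B' × (B × M) => (q.1, q.2.2))
        (by fun_prop) (by fun_prop) ?_
      exact hE
    exact (IsEmbedding.id.prodMap hg.isEmbedding).comp h1
  · obtain ⟨U, V, hU, hbU, hV, hmV, F, hF, hF0⟩ := hg.flat (α b) (E (b, m))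
    have hopen : E ⁻¹' V ∈ 𝓝 (b, m) := (hV.preimage hEc).mem_nhds hmV
    obtain ⟨U₁, V₁, hU₁, hbU₁, hV₁, hmV₁, hsub⟩ := mem_nhds_prod_iff'.1 hopen
    have hFc : Continuous F := continuous_snd.comp hF.continuous
    refine ⟨U₁ ∩ α ⁻¹' U, V₁, hU₁.inter (hU.preimage hα), ⟨hbU₁, hbU⟩, hV₁, hmV₁, ?_⟩
    let L : ((U₁ ∩ α ⁻¹' U : Set B') × V₁) × (Fin c → ℝ) → (U × V) × (Fin c → ℝ) :=
      fun p => ((⟨α p.1.1, p.1.1.2.2⟩, ⟨E (p.1.1, p.1.2), hsub ⟨p.1.1.2.1, p.1.2.2⟩⟩), p.2)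
    have hL : Continuous L := by
      refine Continuous.prodMk (Continuous.prodMk ?_ ?_) continuous_snd
      · exact Continuous.subtype_mk (by fun_prop) _
      · exact Continuous.subtype_mk (by fun_prop) _
    refine ⟨fun p => F (L p), ?_, fun x v => hF0 _ _⟩
    refine IsEmbedding.of_comp (g := fun q : B' × N => (q.1, (α q.1, q.2)))
      (by fun_prop) (by fun_prop) ?_
    have h1 : IsEmbedding (fun p : ((U₁ ∩ α ⁻¹' U : Set B') × V₁) × (Fin c → ℝ) =>
        ((p.1.1 : B'), L p)) := by
      refine IsEmbedding.of_comp
        (g := fun q : B' × ((U × V) × (Fin c → ℝ)) => ((q.1, (q.2.1.2 : M)), q.2.2))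
        (by fun_prop) (by fun_prop) ?_
      exact (hE.comp (IsEmbedding.subtypeVal.prodMap IsEmbedding.subtypeVal)).prodMap
        IsEmbedding.id
    exact (IsEmbedding.id.prodMap hF).comp h1

end LocallyFlat

/-- The standard inclusion `ℝᵃ → ℝᵇ` by zero coordinates (for `a ≤ b`). -/
def pad {a b : ℕ} (x : Fin a → ℝ) : Fin b → ℝ :=
  fun i => if h : (i : ℕ) < a then x ⟨i, h⟩ else 0

theorem pad_self {a : ℕ} (x : Fin a → ℝ) : (pad x : Fin a → ℝ) = x := by
  funext i; simp [pad]

theorem pad_pad {a b c : ℕ} (hab : a ≤ b) (x : Fin a → ℝ) :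
    (pad (pad x : Fin b → ℝ) : Fin c → ℝ) = pad x := by
  funext i
  simp only [pad]
  split_ifs <;> first | rfl | omega

theorem continuous_pad {a b : ℕ} : Continuous (pad : (Fin a → ℝ) → (Fin b → ℝ)) := by
  refine continuous_pi fun i => ?_
  unfold pad
  split_ifs <;> fun_prop

/-- The inclusion `ℝᵃ × ℝ → ℝᵇ × ℝ` which is standard on the first factor and preserves the last
coordinate. -/
def stab {a b : ℕ} (x : (Fin a → ℝ) × ℝ) : (Fin b → ℝ) × ℝ := (pad x.1, x.2)

theorem continuous_stab {a b : ℕ} : Continuous (stab : (Fin a → ℝ) × ℝ → (Fin b → ℝ) × ℝ) :=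
  (continuous_pad.comp continuous_fst).prodMk continuous_snd

/-- Local flatness is preserved by `ℝᵐ⁺ᶜ × ℝ → ℝᵐ⁺ᵈ × ℝ`, for `c ≤ d`. -/
theorem IsLocallyFlatEmbeddingOver.stab {B M : Type*} [TopologicalSpace B] [TopologicalSpace M]
    {m c d : ℕ} (hcd : c ≤ d) {g : B × M → (Fin (m + c) → ℝ) × ℝ}
    (hg : IsLocallyFlatEmbeddingOver (c + 1) g) :
    IsLocallyFlatEmbeddingOver (d + 1)
      (fun p => (LFEmb.stab (g p) : (Fin (m + d) → ℝ) × ℝ)) := by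
  have hgc : Continuous g := continuous_snd.comp hg.isEmbedding.continuous
  have hle : m + c ≤ m + d := by omega
  refine ⟨?_, fun b x => ?_⟩
  · refine IsEmbedding.of_comp
      (g := fun q : B × ((Fin (m + d) → ℝ) × ℝ) =>
        (q.1, ((fun i : Fin (m + c) => q.2.1 (Fin.castLE hle i)), q.2.2)))
      (continuous_fst.prodMk (continuous_stab.comp hgc)) (by fun_prop) ?_
    convert hg.isEmbedding using 1
    funext p
    refine Prod.ext rfl (Prod.ext ?_ rfl)
    funext i
    simp [LFEmb.stab, pad]
  · obtain ⟨U, V, hU, hbU, hV, hmV, F, hF, hF0⟩ := hg.flat b x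
    have hFc : Continuous F := continuous_snd.comp hF.continuous
    refine ⟨U, V, hU, hbU, hV, hmV, ?_⟩
    let hd : (Fin (d + 1) → ℝ) → (Fin (c + 1) → ℝ) :=
      fun s i => s (Fin.castLE (by omega) i)
    let tl : (Fin (d + 1) → ℝ) → (Fin (d - c) → ℝ) :=
      fun s i => s ⟨c + 1 + i, by omega⟩
    have hhd : Continuous hd := by fun_prop
    have htl : Continuous tl := by fun_prop
    let F' : (U × V) × (Fin (d + 1) → ℝ) → (Fin (m + d) → ℝ) × ℝ := fun p =>
      ((fun i => if h : (i : ℕ) < m + c then (F (p.1, hd p.2)).1 ⟨i, h⟩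
          else tl p.2 ⟨i - (m + c), by omega⟩), (F (p.1, hd p.2)).2)
    have hF' : Continuous F' := by
      refine Continuous.prodMk (continuous_pi fun i => ?_) (by fun_prop)
      split_ifs <;> fun_prop
    refine ⟨F', ?_, ?_⟩
    · refine IsEmbedding.of_comp
        (g := fun q : B × ((Fin (m + d) → ℝ) × ℝ) =>
          ((q.1, ((fun i : Fin (m + c) => q.2.1 (Fin.castLE hle i)), q.2.2)),
            fun i : Fin (d - c) => q.2.1 ⟨m + c + i, by omega⟩))
        (by fun_prop) (by fun_prop) ?_
      have h1 : IsEmbedding (fun p : (U × V) × (Fin (d + 1) → ℝ) =>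
          ((p.1, hd p.2), tl p.2)) := by
        refine isEmbedding_of_leftInverse
          (r := fun q => (q.1.1, fun i : Fin (d + 1) =>
            if h : (i : ℕ) < c + 1 then q.1.2 ⟨i, h⟩ else q.2 ⟨i - (c + 1), by omega⟩))
          (by fun_prop) ?_ ?_
        · refine Continuous.prodMk (by fun_prop) (continuous_pi fun i => ?_)
          split_ifs <;> fun_prop
        · intro p
          refine Prod.ext rfl ?_
          funext i
          by_cases h : (i : ℕ) < c + 1
          · simp [h, hd]
          · simp only [h, dif_neg, not_false_eq_true, tl]
            exact congrArg p.2 (Fin.ext (by simp only; omega))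
      convert (hF.prodMap (IsEmbedding.id (X := Fin (d - c) → ℝ))).comp h1 using 1
      funext p
      refine Prod.ext (Prod.ext rfl (Prod.ext ?_ rfl)) ?_
      · funext i
        simp [F']
      · funext i
        simp [F']
    · intro y v
      have h0 : hd 0 = 0 := rfl
      have h0' : tl 0 = 0 := rfl
      simp only [F', h0, h0', hF0, LFEmb.stab]
      rfl

/-! ### Manifolds with boundary a sphere, and collars -/

/-- The boundary of a `d`-dimensional topological manifold with boundary `W`: the points that have
no neighbourhood homeomorphic to an open subset of `ℝᵈ`. -/
def manifoldBoundary (d : ℕ) (W : Type*) [TopologicalSpace W] : Set W :=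
  {x | ∀ e : OpenPartialHomeomorph W (EuclideanSpace ℝ (Fin d)), x ∉ e.source}

/-- The unit sphere `S²ⁿ⁻¹` in `ℝ²ⁿ`. -/
abbrev BdrySphere (n : ℕ) : Type := Metric.sphere (0 : EuclideanSpace ℝ (Fin (2 * n))) 1

/-- The topological simplex `Δᵏ`. -/
abbrev Simp (k : SimplexCategory) : Type := stdSimplex ℝ (Fin (k.len + 1))

/-- The map `Δʲ → Δᵏ` induced by a morphism `[j] → [k]`. -/
abbrev simpMap {j k : SimplexCategory} (θ : j ⟶ k) : Simp j → Simp k := stdSimplex.map θ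

section Collar

variable {n : ℕ} {W : Type u} [TopologicalSpace W]

/-- The gluing relation identifying `h s ∈ ∂W` with `(s, 0)`. -/
def CollarRel (h : BdrySphere n ≃ₜ manifoldBoundary (2 * n) W)
    (x y : W ⊕ (BdrySphere n × Set.Iic (0 : ℝ))) : Prop :=
  ∃ s : BdrySphere n, x = Sum.inl (h s : W) ∧ y = Sum.inr (s, ⟨0, Set.mem_Iic.2 le_rfl⟩)

/-- `W ∪ (S²ⁿ⁻¹ × (-∞, 0])`, glued along `h : S²ⁿ⁻¹ ≅ ∂W`, with the quotient topology. -/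
def Collared (h : BdrySphere n ≃ₜ manifoldBoundary (2 * n) W) : Type u := Quot (CollarRel h)

instance (h : BdrySphere n ≃ₜ manifoldBoundary (2 * n) W) : TopologicalSpace (Collared h) :=
  inferInstanceAs (TopologicalSpace (Quot (CollarRel h)))

variable (h : BdrySphere n ≃ₜ manifoldBoundary (2 * n) W)

def Collared.inl (w : W) : Collared h := Quot.mk _ (Sum.inl w)

def Collared.inr (p : BdrySphere n × Set.Iic (0 : ℝ)) : Collared h := Quot.mk _ (Sum.inr p)

/-- The collar `S²ⁿ⁻¹ × (-ε, 0]`. -/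
def collar (ε : ℝ) : Set (Collared h) :=
  {x | ∃ p : BdrySphere n × Set.Iic (0 : ℝ), -ε < (p.2 : ℝ) ∧ x = Collared.inr h p}

/-- `W ∪ (S²ⁿ⁻¹ × (-ε, 0])`, as a subspace of `W ∪ (S²ⁿ⁻¹ × (-∞, 0])`. -/
def collared (ε : ℝ) : Set (Collared h) := Set.range (Collared.inl h) ∪ collar h ε

/-- The collar coordinate, extended by `0` to `W`. -/
def height : Collared h → ℝ :=
  Quot.lift (Sum.elim (fun _ => 0) (fun p => (p.2 : ℝ))) (by rintro _ _ ⟨s, rfl, rfl⟩; rfl)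

theorem collar_mono {ε ε' : ℝ} (hε : ε' ≤ ε) : collar h ε' ⊆ collar h ε := by
  rintro _ ⟨p, hp, rfl⟩
  exact ⟨p, by linarith, rfl⟩

theorem collared_mono {ε ε' : ℝ} (hε : ε' ≤ ε) : collared h ε' ⊆ collared h ε :=
  Set.union_subset_union_right _ (collar_mono h hε)

theorem mem_collar_of_mem {ε ε' : ℝ} (hε' : 0 < ε') {x : Collared h} (hx : x ∈ collared h ε')
    (hx' : x ∈ collar h ε) : x ∈ collar h ε' := by
  rcases hx with ⟨w, rfl⟩ | hx
  · obtain ⟨p, -, hp⟩ := hx'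
    refine ⟨p, ?_, hp⟩
    have : (0 : ℝ) = p.2 := congrArg (height h) hp
    linarith
  · exact hx

end Collar

/-! ### The simplicial group of homeomorphisms -/

section Homeo

variable (d : ℕ) (W : Type u) [TopologicalSpace W]

/-- The group of homeomorphisms of `Δᵏ × W` over `Δᵏ` that are the identity on `Δᵏ × ∂W`. -/
def topBdry (k : SimplexCategory) : Subgroup ((Simp k × W) ≃ₜ (Simp k × W)) where
  carrier := {φ | (∀ p, (φ p).1 = p.1) ∧ ∀ p, p.2 ∈ manifoldBoundary d W → φ p = p}
  mul_mem' := by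
    rintro φ ψ ⟨h1, h2⟩ ⟨h3, h4⟩
    refine ⟨fun p => ?_, fun p hp => ?_⟩
    · change (φ (ψ p)).1 = p.1
      rw [h1, h3]
    · change φ (ψ p) = p
      rw [h4 p hp, h2 p hp]
  one_mem' := ⟨fun _ => rfl, fun _ _ => rfl⟩
  inv_mem' := by
    rintro φ ⟨h1, h2⟩
    refine ⟨fun p => ?_, fun p hp => ?_⟩
    · change (φ.symm p).1 = p.1
      rw [← h1 (φ.symm p), φ.apply_symm_apply]
    · change φ.symm p = p
      rw [φ.symm_apply_eq, h2 p hp]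

variable {d W}

theorem topBdry.eta {k : SimplexCategory} (φ : topBdry d W k) (t : Simp k) (w : W) :
    φ.1 (t, w) = (t, (φ.1 (t, w)).2) :=
  Prod.ext (φ.2.1 (t, w)) rfl

theorem topBdry.mul_snd {k : SimplexCategory} (φ ψ : topBdry d W k) (t : Simp k) (w : W) :
    ((φ * ψ).1 (t, w)).2 = (φ.1 (t, (ψ.1 (t, w)).2)).2 := by
  change (φ.1 (ψ.1 (t, w))).2 = _
  rw [topBdry.eta ψ]

theorem topBdry.inv_snd {k : SimplexCategory} (φ : topBdry d W k) (t : Simp k) (w : W) :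
    (φ.1 (t, ((φ⁻¹).1 (t, w)).2)).2 = w := by
  rw [← topBdry.mul_snd, mul_inv_cancel]; rfl

theorem topBdry.inv_snd' {k : SimplexCategory} (φ : topBdry d W k) (t : Simp k) (w : W) :
    ((φ⁻¹).1 (t, (φ.1 (t, w)).2)).2 = w := by
  rw [← topBdry.mul_snd, inv_mul_cancel]; rfl

theorem topBdry.ext_snd {k : SimplexCategory} {φ ψ : topBdry d W k}
    (h : ∀ t w, (φ.1 (t, w)).2 = (ψ.1 (t, w)).2) : φ = ψ := by
  refine Subtype.ext (Homeomorph.ext fun p => ?_)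
  obtain ⟨t, w⟩ := p
  rw [topBdry.eta, topBdry.eta ψ, h]

/-- Restriction of a family of homeomorphisms along `Δʲ → Δᵏ`. -/
def topBdry.pullback {j k : SimplexCategory} (θ : j ⟶ k) : topBdry d W k →* topBdry d W j where
  toFun φ :=
    ⟨{ toFun := fun p => (p.1, (φ.1 (simpMap θ p.1, p.2)).2)
       invFun := fun p => (p.1, ((φ⁻¹).1 (simpMap θ p.1, p.2)).2)
       left_inv := fun p => Prod.ext rfl (topBdry.inv_snd' φ _ _)
       right_inv := fun p => Prod.ext rfl (topBdry.inv_snd φ _ _)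
       continuous_toFun := by
         have := stdSimplex.continuous_map (S := ℝ) θ
         have := φ.1.continuous
         fun_prop
       continuous_invFun := by
         have := stdSimplex.continuous_map (S := ℝ) θ
         have := (φ⁻¹).1.continuous
         fun_prop },
      fun _ => rfl, fun p hp => Prod.ext rfl (by
        change (φ.1 (simpMap θ p.1, p.2)).2 = p.2
        rw [φ.2.2 _ hp])⟩
  map_one' := rfl
  map_mul' φ ψ := topBdry.ext_snd fun t w => topBdry.mul_snd φ ψ _ _

variable (d W) in
/-- The simplicial group `Top_∂(W)`. -/
def TopBdry : SimplicialObject GrpCat.{u} where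
  obj k := GrpCat.of (topBdry d W k.unop)
  map θ := GrpCat.ofHom (topBdry.pullback θ.unop)
  map_id k := by
    refine GrpCat.hom_ext (MonoidHom.ext fun φ => topBdry.ext_snd fun t w => ?_)
    change (φ.1 (stdSimplex.map id t, w)).2 = _
    rw [stdSimplex.map_id_apply]; rfl
  map_comp {j k l} θ η := by
    refine GrpCat.hom_ext (MonoidHom.ext fun φ => topBdry.ext_snd fun t w => ?_)
    change (φ.1 (stdSimplex.map (θ.unop ∘ η.unop) t, w)).2 =
      (φ.1 (stdSimplex.map θ.unop (stdSimplex.map η.unop t), w)).2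
    rw [stdSimplex.map_comp_apply]

end Homeo

/-! ### Extending homeomorphisms over the collar -/

section Extend

variable {n : ℕ} {W : Type u} [TopologicalSpace W]
  (h : BdrySphere n ≃ₜ manifoldBoundary (2 * n) W)

/-- The extension of `φ` to `W ∪ (S²ⁿ⁻¹ × (-∞, 0])` by the identity on the collar. -/
def extend {k : SimplexCategory} (φ : topBdry (2 * n) W k) (t : Simp k) :
    Collared h → Collared h :=
  Quot.lift (Sum.elim (fun w => Collared.inl h (φ.1 (t, w)).2) (fun p => Collared.inr h p)) (by
    rintro _ _ ⟨s, rfl, rfl⟩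
    simp only [Sum.elim_inl, Sum.elim_inr]
    rw [φ.2.2 (t, (h s : W)) (h s).2]
    exact Quot.sound ⟨s, rfl, rfl⟩)

@[simp] theorem extend_inl {k : SimplexCategory} (φ : topBdry (2 * n) W k) (t : Simp k) (w : W) :
    extend h φ t (Collared.inl h w) = Collared.inl h (φ.1 (t, w)).2 := rfl

@[simp] theorem extend_inr {k : SimplexCategory} (φ : topBdry (2 * n) W k) (t : Simp k)
    (p : BdrySphere n × Set.Iic (0 : ℝ)) :
    extend h φ t (Collared.inr h p) = Collared.inr h p := rfl

theorem Collared.cases {P : Collared h → Prop} (h1 : ∀ w, P (Collared.inl h w))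
    (h2 : ∀ p, P (Collared.inr h p)) (x : Collared h) : P x := by
  obtain ⟨x, rfl⟩ := Quot.exists_rep x
  cases x with
  | inl w => exact h1 w
  | inr p => exact h2 p

theorem extend_mul {k : SimplexCategory} (φ ψ : topBdry (2 * n) W k) (t : Simp k)
    (x : Collared h) : extend h (φ * ψ) t x = extend h φ t (extend h ψ t x) := by
  refine Collared.cases h (P := fun x => extend h (φ * ψ) t x = extend h φ t (extend h ψ t x))
    (fun w => ?_) (fun p => rfl) x
  simp only [extend_inl, topBdry.mul_snd]

theorem extend_one {k : SimplexCategory} (t : Simp k) (x : Collared h) :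
    extend h (1 : topBdry (2 * n) W k) t x = x :=
  Collared.cases h (P := fun x => extend h (1 : topBdry (2 * n) W k) t x = x)
    (fun _ => rfl) (fun _ => rfl) x

theorem extend_mem {k : SimplexCategory} (φ : topBdry (2 * n) W k) (t : Simp k) {ε : ℝ}
    {x : Collared h} (hx : x ∈ collared h ε) : extend h φ t x ∈ collared h ε := by
  rcases hx with ⟨w, rfl⟩ | ⟨p, hp, rfl⟩
  · exact Or.inl ⟨_, rfl⟩
  · exact Or.inr ⟨p, hp, rfl⟩

theorem extend_mem_collar {k : SimplexCategory} (φ : topBdry (2 * n) W k) (t : Simp k) {ε : ℝ}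
    {x : Collared h} (hx : x ∈ collar h ε) : extend h φ t x = x := by
  rcases hx with ⟨p, hp, rfl⟩
  rfl

theorem continuous_extend {k : SimplexCategory} (φ : topBdry (2 * n) W k) :
    Continuous (fun p : Simp k × Collared h => extend h φ p.1 p.2) := by
  have hq : IsQuotientMap (Quot.mk (CollarRel h)) := isQuotientMap_quot_mk
  have : CompactSpace (Simp k) := isCompact_iff_compactSpace.1 (isCompact_stdSimplex ℝ _)
  refine hq.continuous_lift_prod_right (Y := Simp k) (X := Collared h)
    (g := fun p : Simp k × Collared h => extend h φ p.1 p.2) ?_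
  have hφ := φ.1.continuous
  have hmk : Continuous (Quot.mk (CollarRel h)) := continuous_quot_mk
  have key : Continuous
      ((fun p : Simp k × (W ⊕ (BdrySphere n × Set.Iic (0 : ℝ))) =>
        extend h φ p.1 (Quot.mk _ p.2)) ∘ Homeomorph.prodSumDistrib.symm) := by
    refine continuous_sum_dom.2 ⟨?_, ?_⟩
    · exact hmk.comp (continuous_inl.comp (continuous_snd.comp hφ))
    · exact hmk.comp (continuous_inr.comp continuous_snd)
  exact (Homeomorph.comp_continuous_iff' _).1 key

/-- The extension of `φ`, restricted to `W ∪ (S²ⁿ⁻¹ × (-ε, 0])`. -/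
def extendOn {k : SimplexCategory} (φ : topBdry (2 * n) W k) (ε : ℝ)
    (p : Simp k × collared h ε) : collared h ε :=
  ⟨extend h φ p.1 p.2, extend_mem h φ p.1 p.2.2⟩

theorem isEmbedding_extendOn {k : SimplexCategory} (φ : topBdry (2 * n) W k) (ε : ℝ) :
    IsEmbedding (fun p : Simp k × collared h ε => (p.1, extendOn h φ ε p)) := by
  have hc : ∀ ψ : topBdry (2 * n) W k,
      Continuous (fun p : Simp k × collared h ε => (p.1, extendOn h ψ ε p)) := fun ψ =>
    continuous_fst.prodMk (Continuous.subtype_mk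
      ((continuous_extend h ψ).comp (continuous_fst.prodMk (by fun_prop))) _)
  refine isEmbedding_of_leftInverse (hc φ) (hc φ⁻¹) fun p => ?_
  refine Prod.ext rfl (Subtype.ext ?_)
  change extend h φ⁻¹ p.1 (extend h φ p.1 p.2) = p.2
  rw [← extend_mul, inv_mul_cancel, extend_one]

end Extend

/-! ### The simplicial set of embeddings -/

section Emb

variable {n : ℕ} {W : Type u} [TopologicalSpace W]
  (h : BdrySphere n ≃ₜ manifoldBoundary (2 * n) W)

/-- The standard embedding `S²ⁿ⁻¹ × (-∞, 0] → ℝ²ⁿ × (-∞, 0] → ℝ²ⁿ⁺ᶜ × ℝ`. -/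
def std (c : ℕ) (p : BdrySphere n × Set.Iic (0 : ℝ)) : (Fin (2 * n + c) → ℝ) × ℝ :=
  (pad (fun i => p.1.1 i), p.2)

/-- The `k`-simplices of `Emb^lf_ε(W, ℝᴺ)` for `N = 2n + c + 1`, with `ℝᴺ` written as `ℝᴺ⁻¹ × ℝ`:
locally flat embeddings `e` of `Δᵏ × (W ∪ (S²ⁿ⁻¹ × (-ε, 0]))` into `Δᵏ × ℝᴺ⁻¹ × ℝ` over `Δᵏ` (given
by their second component) which are standard on the collar, and such that the preimage of
`Δᵏ × ℝᴺ⁻¹ × (-∞, 0]` is the collar. -/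
@[ext]
structure EmbSimplex (c : ℕ) (ε : ℝ) (k : SimplexCategory) where
  toFun : Simp k × collared h ε → (Fin (2 * n + c) → ℝ) × ℝ
  locallyFlat : IsLocallyFlatEmbeddingOver (c + 1) toFun
  eq_std : ∀ (t : Simp k) (p : BdrySphere n × Set.Iic (0 : ℝ)) (hp : -ε < (p.2 : ℝ)),
    toFun (t, ⟨Collared.inr h p, Or.inr ⟨p, hp, rfl⟩⟩) = std c p
  nonpos_iff : ∀ (t : Simp k) (x : collared h ε),
    (toFun (t, x)).2 ≤ 0 ↔ (x : Collared h) ∈ collar h ε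

variable {h}

/-- Restriction along `Δʲ → Δᵏ`. -/
def EmbSimplex.pullback {c : ℕ} {ε : ℝ} {j k : SimplexCategory} (θ : j ⟶ k)
    (e : EmbSimplex h c ε k) : EmbSimplex h c ε j where
  toFun p := e.toFun (simpMap θ p.1, p.2)
  locallyFlat := e.locallyFlat.precomp (simpMap θ) (stdSimplex.continuous_map θ) Prod.snd
    IsEmbedding.id
  eq_std _ := fun p hp => e.eq_std _ p hp
  nonpos_iff _ _ := e.nonpos_iff _ _

/-- Restriction to a smaller collar, and the inclusion into a larger Euclidean space. -/
def EmbSimplex.transition {c c' : ℕ} {ε ε' : ℝ} (hc : c ≤ c') (hε' : 0 < ε') (hε : ε' ≤ ε)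
    {k : SimplexCategory}
    (e : EmbSimplex h c ε k) : EmbSimplex h c' ε' k where
  toFun p := stab (e.toFun (p.1, Set.inclusion (collared_mono h hε) p.2))
  locallyFlat := (e.locallyFlat.precomp id continuous_id
    (fun p => Set.inclusion (collared_mono h hε) p.2)
    (IsEmbedding.id.prodMap (IsEmbedding.inclusion (collared_mono h hε)))).stab hc
  eq_std t p hp := by
    change stab (e.toFun (t, ⟨Collared.inr h p, _⟩)) = _
    rw [e.eq_std t p (by linarith)]
    exact Prod.ext (pad_pad (by omega) _) rfl
  nonpos_iff t x := by
    refine (e.nonpos_iff t _).trans ⟨fun hx => mem_collar_of_mem h hε' x.2 hx,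
      fun hx => collar_mono h hε hx⟩

/-- The action of a family of homeomorphisms, `φ • e = e ∘ φ⁻¹`, where `φ` is extended by the
identity on the collar. -/
def EmbSimplex.act {c : ℕ} {ε : ℝ} {k : SimplexCategory} (φ : topBdry (2 * n) W k)
    (e : EmbSimplex h c ε k) : EmbSimplex h c ε k where
  toFun p := e.toFun (p.1, extendOn h φ⁻¹ ε p)
  locallyFlat := e.locallyFlat.precomp id continuous_id (extendOn h φ⁻¹ ε)
    (isEmbedding_extendOn h φ⁻¹ ε)
  eq_std t p hp := e.eq_std t p hp
  nonpos_iff t x := by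
    refine (e.nonpos_iff t _).trans ⟨fun hx => ?_, fun hx => ?_⟩
    · have := extend_mem_collar h φ t hx
      change extend h φ t (extend h φ⁻¹ t x) = extend h φ⁻¹ t x at this
      rw [← extend_mul, mul_inv_cancel, extend_one] at this
      rw [this]; exact hx
    · change extend h φ⁻¹ t x ∈ _
      rw [extend_mem_collar h φ⁻¹ t hx]; exact hx

theorem EmbSimplex.pullback_id {c : ℕ} {ε : ℝ} {k : SimplexCategory} (e : EmbSimplex h c ε k) :
    e.pullback (𝟙 k) = e := by
  refine EmbSimplex.ext (funext fun p => ?_)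
  change e.toFun (stdSimplex.map id p.1, p.2) = _
  rw [stdSimplex.map_id_apply]

theorem EmbSimplex.pullback_comp {c : ℕ} {ε : ℝ} {i j k : SimplexCategory} (η : i ⟶ j) (θ : j ⟶ k)
    (e : EmbSimplex h c ε k) : e.pullback (η ≫ θ) = (e.pullback θ).pullback η := by
  refine EmbSimplex.ext (funext fun p => ?_)
  change e.toFun (stdSimplex.map (θ ∘ η) p.1, p.2) =
    e.toFun (stdSimplex.map θ (stdSimplex.map η p.1), p.2)
  rw [stdSimplex.map_comp_apply]

theorem EmbSimplex.act_one {c : ℕ} {ε : ℝ} {k : SimplexCategory} (e : EmbSimplex h c ε k) :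
    e.act 1 = e := by
  refine EmbSimplex.ext (funext fun p => ?_)
  refine congrArg (fun y => e.toFun (p.1, y)) (Subtype.ext ?_)
  change extend h (1 : topBdry (2 * n) W k)⁻¹ p.1 p.2 = p.2
  rw [inv_one, extend_one]

theorem EmbSimplex.act_mul {c : ℕ} {ε : ℝ} {k : SimplexCategory} (φ ψ : topBdry (2 * n) W k)
    (e : EmbSimplex h c ε k) : e.act (φ * ψ) = (e.act ψ).act φ := by
  refine EmbSimplex.ext (funext fun p => ?_)
  refine congrArg (fun y => e.toFun (p.1, y)) (Subtype.ext ?_)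
  change extend h (φ * ψ)⁻¹ p.1 p.2 = extend h ψ⁻¹ p.1 (extend h φ⁻¹ p.1 p.2)
  rw [mul_inv_rev, extend_mul]

theorem EmbSimplex.pullback_act {c : ℕ} {ε : ℝ} {j k : SimplexCategory} (θ : j ⟶ k)
    (φ : topBdry (2 * n) W k) (e : EmbSimplex h c ε k) :
    (e.act φ).pullback θ = (e.pullback θ).act (topBdry.pullback θ φ) := by
  refine EmbSimplex.ext (funext fun p => ?_)
  refine congrArg (fun y => e.toFun (simpMap θ p.1, y)) (Subtype.ext ?_)
  change extend h φ⁻¹ (simpMap θ p.1) p.2 = extend h (topBdry.pullback θ φ)⁻¹ p.1 p.2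
  rw [← map_inv]
  exact Collared.cases h (P := fun x => extend h φ⁻¹ (simpMap θ p.1) x =
    extend h (topBdry.pullback θ φ⁻¹) p.1 x) (fun _ => rfl) (fun _ => rfl) _

/-- The index set of the colimit over `N = 2n + c + 1 → ∞` and `ε → 0`. -/
abbrev Idx : Type := ℕ × {ε : ℝ // 0 < ε}ᵒᵈ

/-- The transition maps of the directed system of `k`-simplices. -/
def embTransition (k : SimplexCategory) (i j : Idx) (hij : i ≤ j) :
    TypeCat.Fun (EmbSimplex h i.1 i.2.ofDual.1 k) (EmbSimplex h j.1 j.2.ofDual.1 k) :=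
  ⟨fun e => e.transition hij.1 j.2.ofDual.2 hij.2⟩

instance (k : SimplexCategory) : DirectedSystem
    (fun i : Idx => EmbSimplex h i.1 i.2.ofDual.1 k) (embTransition (h := h) k · · ·) where
  map_self i e := by
    refine EmbSimplex.ext (funext fun p => ?_)
    exact Prod.ext (pad_self _) rfl
  map_map k j i hij hjk e := by
    refine EmbSimplex.ext (funext fun p => ?_)
    exact Prod.ext (pad_pad (Nat.add_le_add_left hij.1 _) _) rfl

variable (h) in
/-- The `k`-simplices of `Emb^lf_∂(W, ℝ^∞)`: the colimit of the sets of `k`-simplices of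
`Emb^lf_ε(W, ℝᴺ)` as `ε → 0` and `N → ∞`. -/
abbrev EmbInfSimplex (k : SimplexCategory) : Type u :=
  DirectLimit (fun i : Idx => EmbSimplex h i.1 i.2.ofDual.1 k) (embTransition k)

/-- Restriction along `Δʲ → Δᵏ` in the colimit. -/
def EmbInfSimplex.pullback {j k : SimplexCategory} (θ : j ⟶ k) :
    EmbInfSimplex h k → EmbInfSimplex h j :=
  DirectLimit.map (embTransition k) (embTransition j)
    (fun _ e => e.pullback θ) (fun _ _ _ _ => rfl)

variable (h) in
/-- The simplicial set `Emb^lf_∂(W, ℝ^∞)`. -/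
def EmbInf : SSet.{u} where
  obj k := EmbInfSimplex h k.unop
  map θ := TypeCat.ofHom (EmbInfSimplex.pullback θ.unop)
  map_id k := by
    ext x
    obtain ⟨i, e, rfl⟩ := DirectLimit.exists_eq_mk _ x
    exact congrArg (fun y => (⟦⟨i, y⟩⟧ : EmbInfSimplex h k.unop)) e.pullback_id
  map_comp {j k l} θ η := by
    ext x
    obtain ⟨i, e, rfl⟩ := DirectLimit.exists_eq_mk _ x
    exact congrArg (fun y => (⟦⟨i, y⟩⟧ : EmbInfSimplex h l.unop)) (e.pullback_comp η.unop θ.unop)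

/-- The action of `Top_∂(W)_k` on the `k`-simplices of `Emb^lf_∂(W, ℝ^∞)`. -/
def EmbInfSimplex.act {k : SimplexCategory} (φ : topBdry (2 * n) W k) :
    EmbInfSimplex h k → EmbInfSimplex h k :=
  DirectLimit.map (embTransition k) (embTransition k)
    (fun _ e => e.act φ) (fun _ _ _ _ => rfl)

end Emb

/-! ### Actions of simplicial groups and classifying spaces -/

section Classifying

/-- An action of a simplicial group on a simplicial set. -/
class SimplicialAction (G : SimplicialObject GrpCat.{u}) (X : SSet.{u}) where
  mulAction : ∀ k, MulAction (G.obj k) (X.obj k)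
  map_smul : ∀ {k l : SimplexCategoryᵒᵖ} (θ : k ⟶ l) (g : G.obj k) (x : X.obj k),
    X.map θ (g • x) = G.map θ g • X.map θ x

attribute [reducible, instance] SimplicialAction.mulAction

variable (G : SimplicialObject GrpCat.{u}) (X Y : SSet.{u}) [SimplicialAction G X]
  [SimplicialAction G Y]

/-- The action is free in each simplicial degree. -/
def IsLevelwiseFree : Prop :=
  ∀ (k : SimplexCategoryᵒᵖ) (g : G.obj k) (x : X.obj k), g • x = x → g = 1

/-- The quotient simplicial set `X / G`. -/
def orbitSpace : SSet.{u} where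
  obj k := MulAction.orbitRel.Quotient (G.obj k) (X.obj k)
  map {k l} θ := TypeCat.ofHom (Quotient.map' (s₁ := MulAction.orbitRel (G.obj k) (X.obj k))
    (s₂ := MulAction.orbitRel (G.obj l) (X.obj l)) (X.map θ) (by
      rintro _ y ⟨g, rfl⟩
      exact ⟨G.map θ g, (SimplicialAction.map_smul θ g y).symm⟩))
  map_id k := by
    ext x
    induction x using Quotient.inductionOn' with
    | _ x => exact congrArg Quotient.mk'' (by simp)
  map_comp θ η := by
    ext x
    induction x using Quotient.inductionOn' with
    | _ x => exact congrArg Quotient.mk'' (by simp)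

variable {X Y} in
/-- Equivariance of a map of simplicial sets with `G`-action. -/
def IsEquivariant (F : X ⟶ Y) : Prop :=
  ∀ (k : SimplexCategoryᵒᵖ) (g : G.obj k) (x : X.obj k), F.app k (g • x) = g • F.app k x

variable {X Y} in
/-- The map `X / G ⟶ Y / G` induced by an equivariant map. -/
def orbitMap (F : X ⟶ Y) (hF : IsEquivariant G F) : orbitSpace G X ⟶ orbitSpace G Y where
  app k := TypeCat.ofHom (Quotient.map' (s₁ := MulAction.orbitRel (G.obj k) (X.obj k))
    (s₂ := MulAction.orbitRel (G.obj k) (Y.obj k)) (F.app k) (by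
      rintro _ y ⟨g, rfl⟩
      exact ⟨g, (hF k g y).symm⟩))
  naturality k l θ := by
    ext x
    induction x using Quotient.inductionOn' with
    | _ x => exact congrArg Quotient.mk'' (NatTrans.naturality_apply F θ x)

/-- The universal `G`-space `EG`: the diagonal of the bisimplicial set obtained by applying to each
group `G_k` the construction with `p`-simplices `G_k^{p+1}`. So `(EG)_k = G_k^{k+1}`, and
`θ : [l] → [k]` sends `(g_0, …, g_k)` to `(θ^* g_{θ 0}, …, θ^* g_{θ l})`. -/
def EG : SSet.{u} where
  obj k := Fin (k.unop.len + 1) → G.obj k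
  map θ := TypeCat.ofHom fun g i => G.map θ (g (θ.unop i))
  map_id k := by
    ext g i
    simp
  map_comp θ η := by
    ext g i
    simp

/-- `G` acts on `EG` by simultaneous left multiplication. -/
instance : SimplicialAction G (EG G) where
  mulAction k := inferInstanceAs (MulAction (G.obj k) (Fin (k.unop.len + 1) → G.obj k))
  map_smul θ g x := funext fun i => map_mul (G.map θ).hom g (x (θ.unop i))

/-- The classifying space `BG = EG / G`. It is the diagonal of the bisimplicial set obtained by
taking the nerve of each group `G_k`. -/
def BG : SSet.{u} := orbitSpace G (EG G)

end Classifying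

/-- `Top_∂(W)` acts on `Emb^lf_∂(W, ℝ^∞)`, by `φ • e = e ∘ φ⁻¹`. -/
instance {n : ℕ} {W : Type u} [TopologicalSpace W]
    (h : BdrySphere n ≃ₜ manifoldBoundary (2 * n) W) :
    SimplicialAction (TopBdry (2 * n) W) (EmbInf h) where
  mulAction k :=
    { smul := fun φ x => EmbInfSimplex.act (k := k.unop) φ x
      one_smul := fun x => by
        obtain ⟨i, e, rfl⟩ := DirectLimit.exists_eq_mk _ x
        exact congrArg (fun y => (⟦⟨i, y⟩⟧ : EmbInfSimplex h k.unop)) e.act_one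
      mul_smul := fun φ ψ x => by
        obtain ⟨i, e, rfl⟩ := DirectLimit.exists_eq_mk _ x
        exact congrArg (fun y => (⟦⟨i, y⟩⟧ : EmbInfSimplex h k.unop)) (e.act_mul φ ψ) }
  map_smul {k l} θ φ x := by
    obtain ⟨i, e, rfl⟩ := DirectLimit.exists_eq_mk _ x
    exact congrArg (fun y => (⟦⟨i, y⟩⟧ : EmbInfSimplex h l.unop)) (e.pullback_act θ.unop φ)

/-! ### Weak contractibility and weak equivalences -/

/-- A simplicial set is weakly contractible if its geometric realization is non-empty and has
trivial homotopy groups (including `π₀`) at all base points. -/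
def IsWeaklyContractible (X : SSet.{u}) : Prop :=
  Nonempty |X| ∧ ∀ (m : ℕ) (x : |X|), Subsingleton (HomotopyGroup.Pi m |X| x)

/-- A map of simplicial sets is an equivalence if its geometric realization is a homotopy
equivalence. (Realizations are CW complexes, for which weak equivalences are homotopy
equivalences.) -/
def IsRealizationEquiv {X Y : SSet.{u}} (f : X ⟶ Y) : Prop :=
  ∃ e : ContinuousMap.HomotopyEquiv |X| |Y|, e.toFun = (SSet.toTop.map f).hom

end LFEmb

end

/-!
The space of embeddings is trivially fibrant over the point, i.e. every family of embeddings over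
the boundary of a simplex extends over the simplex: a continuous extension exists by Tietze, and it
becomes injective after adding, in new ambient coordinates, an embedding of `W / ∂W` scaled by a
function which vanishes exactly on the boundary of the simplex. Local flatness is automatic after
stabilization: the coordinates of a chart of `W` extend to functions on the ambient space, and their
graph straightens the embedding.

If a simplicial group `G` acts freely on `X`, and `X` and hence `X × EG` are trivially fibrant, then
`(X × EG) / G` is trivially fibrant over both `X / G` and `BG`. A section of the first map composed
with the second one is the classifying map. Trivial fibrations realize to homotopy equivalences
since any two lifts are simplicially homotopic. That simplicial homotopies realize to homotopies
is seen by describing a point of `Δᵏ × Δˡ` by a coupling of its components whose support is a chain.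
-/

noncomputable section

namespace LFEmb

/-! ### Points of geometric realizations -/

section Realization

variable {X Y : SSet.{u}}

/-- The characteristic map `Δᵏ → |X|` of a `k`-simplex `x` of `X`. -/
def charMap {k : SimplexCategory} (x : X.obj (op k)) : C(Simp k, |X|) :=
  TopCat.toSSetObjEquiv |X| (op k) ((sSetTopAdj.unit.app X).app (op k) x)

theorem charMap_map {j k : SimplexCategory} (θ : j ⟶ k) (x : X.obj (op k)) (t : Simp j) :
    charMap (X.map θ.op x) t = charMap x (simpMap θ t) := by
  have h := ConcreteCategory.congr_hom ((sSetTopAdj.unit.app X).naturality θ.op) x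
  exact congrArg (fun y => TopCat.toSSetObjEquiv |X| (op j) y t) h

theorem toTop_map_charMap (f : X ⟶ Y) {k : SimplexCategory} (x : X.obj (op k)) (t : Simp k) :
    SSet.toTop.map f (charMap x t) = charMap (f.app (op k) x) t := by
  have h := congrArg (fun g => TopCat.toSSetObjEquiv |Y| (op k) (g.app (op k) x) t)
    (sSetTopAdj.unit.naturality f)
  exact h.symm

theorem exists_toTop_desc {T : TopCat.{u}}
    (φ : ∀ {k : SimplexCategory}, X.obj (op k) → C(Simp k, T))
    (hφ : ∀ {j k : SimplexCategory} (θ : j ⟶ k) (x : X.obj (op k)) (t : Simp j),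
      φ (X.map θ.op x) t = φ x (simpMap θ t)) :
    ∃ g : |X| ⟶ T, ∀ {k : SimplexCategory} (x : X.obj (op k)) (t : Simp k),
      g (charMap x t) = φ x t := by
  let s : X ⟶ TopCat.toSSet.obj T :=
    { app := fun k => TypeCat.ofHom fun x => (TopCat.toSSetObjEquiv T k).symm (φ x)
      naturality := fun k l θ => by
        ext x
        apply (TopCat.toSSetObjEquiv T l).injective
        ext t
        exact hφ θ.unop x t }
  have hs := (sSetTopAdj.homEquiv_unit X T ((sSetTopAdj.homEquiv X T).symm s)).symm.trans
    (Equiv.apply_symm_apply _ _)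
  exact ⟨(sSetTopAdj.homEquiv X T).symm s, fun {k} x t =>
    congrArg (fun g => TopCat.toSSetObjEquiv T (op k) (g.app (op k) x) t) hs⟩

theorem toTop_hom_ext {T : TopCat.{u}} {f g : |X| ⟶ T}
    (h : ∀ {k : SimplexCategory} (x : X.obj (op k)) (t : Simp k),
      f (charMap x t) = g (charMap x t)) : f = g := by
  apply (sSetTopAdj.homEquiv X T).injective
  rw [Adjunction.homEquiv_unit, Adjunction.homEquiv_unit]
  ext k x
  apply (TopCat.toSSetObjEquiv T k).injective
  ext t
  exact h x t

end Realization

/-! ### Monotone couplings of points of simplices -/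

section Coupling

theorem sum_stdSimplex_map_mul {ι κ : Type*} [Fintype ι] [Fintype κ] (f : ι → κ)
    (t : stdSimplex ℝ ι) (u : κ → ℝ) :
    ∑ b, stdSimplex.map f t b * u b = ∑ a, t a * u (f a) := by
  classical
  simp only [stdSimplex.map_coe, FunOnFinite.linearMap_apply_apply, Finset.sum_mul]
  rw [← Finset.sum_fiberwise (s := Finset.univ) (g := f)]
  refine Finset.sum_congr rfl fun b _ => Finset.sum_congr rfl fun a ha => ?_
  rw [(Finset.mem_filter.1 ha).2]

theorem stdSimplex_ext_of_sum_mul {ι : Type*} [Fintype ι] {t t' : stdSimplex ℝ ι}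
    (h : ∀ u : ι → ℝ, ∑ i, t i * u i = ∑ i, t' i * u i) : t = t' := by
  classical
  refine stdSimplex.ext (funext fun i => ?_)
  simpa only [Pi.single_apply, mul_ite, mul_one, mul_zero, Finset.sum_ite_eq', Finset.mem_univ,
    if_true] using h (Pi.single i 1)

theorem stdSimplex_exists_coord_ne_zero {ι : Type*} [Fintype ι] (t : stdSimplex ℝ ι) :
    ∃ i, t i ≠ 0 := by
  by_contra! h
  exact zero_ne_one ((Finset.sum_eq_zero fun i _ => h i).symm.trans (stdSimplex.sum_eq_one t))

theorem exists_orderHom_retraction {ι : Type*} [LinearOrder ι] (S : Finset ι)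
    (hS : S.Nonempty) : ∃ ρ : ι →o ι, (∀ a, ρ a ∈ S) ∧ ∀ a ∈ S, ρ a = a := by
  let A : ι → Finset ι := fun a => insert (S.min' hS) (S.filter (· ≤ a))
  have hA : ∀ a, (A a).Nonempty := fun a => Finset.insert_nonempty _ _
  have hAS : ∀ a, A a ⊆ S := fun a =>
    Finset.insert_subset (S.min'_mem hS) (Finset.filter_subset _ _)
  refine ⟨⟨fun a => (A a).max' (hA a), fun a b hab => ?_⟩,
    fun a => hAS a (Finset.max'_mem _ (hA a)), fun a ha => ?_⟩
  · refine Finset.max'_subset _ (Finset.insert_subset_insert _ fun c hc => ?_)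
    rw [Finset.mem_filter] at hc ⊢
    exact ⟨hc.1, hc.2.trans hab⟩
  · refine le_antisymm (Finset.max'_le _ (hA a) _ fun c hc => ?_) (Finset.le_max' _ _ ?_)
    · rcases Finset.mem_insert.1 hc with rfl | hc
      · exact S.min'_le a ha
      · exact (Finset.mem_filter.1 hc).2
    · exact Finset.mem_insert_of_mem (Finset.mem_filter.2 ⟨ha, le_rfl⟩)

theorem exists_orderHom_map_eq_self {ι : Type*} [Fintype ι] [LinearOrder ι]
    (t : stdSimplex ℝ ι) :
    ∃ ρ : ι →o ι, (∀ a, t (ρ a) ≠ 0) ∧ stdSimplex.map ρ t = t := by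
  obtain ⟨i, hi⟩ := stdSimplex_exists_coord_ne_zero t
  obtain ⟨ρ, hρ, hρ'⟩ := exists_orderHom_retraction (Finset.univ.filter fun i => t i ≠ 0)
    ⟨i, Finset.mem_filter.2 ⟨Finset.mem_univ i, hi⟩⟩
  refine ⟨ρ, fun a => (Finset.mem_filter.1 (hρ a)).2, stdSimplex_ext_of_sum_mul fun u => ?_⟩
  rw [sum_stdSimplex_map_mul]
  refine Finset.sum_congr rfl fun a _ => ?_
  by_cases ha : t a = 0
  · rw [ha, zero_mul, zero_mul]
  · rw [hρ' a (Finset.mem_filter.2 ⟨Finset.mem_univ _, ha⟩)]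

theorem le_of_stdSimplex_map_eq {ι κ : Type*} [Fintype ι] [LinearOrder ι] [Fintype κ]
    [LinearOrder κ] {f g : ι → κ} (hf : Monotone f) (hg : Monotone g) {t : stdSimplex ℝ ι}
    (h : stdSimplex.map f t = stdSimplex.map g t) {i : ι} (hi : t i ≠ 0) : g i ≤ f i := by
  by_contra! hlt
  have hmono : ∀ a, t a * (if g a ≤ f i then 1 else 0) ≤ t a * (if f a ≤ f i then 1 else 0) := by
    intro a
    refine mul_le_mul_of_nonneg_left ?_ (stdSimplex.zero_le t a)
    split_ifs with hga hfa
    · exact le_rfl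
    · exact absurd (hf (hg.reflect_lt (hga.trans_lt hlt)).le) hfa
    · exact zero_le_one
    · exact le_rfl
  have hstrict : ∑ a, t a * (if g a ≤ f i then 1 else 0) <
      ∑ a, t a * (if f a ≤ f i then 1 else 0) := by
    refine Finset.sum_lt_sum (fun a _ => hmono a) ⟨i, Finset.mem_univ i, ?_⟩
    rw [if_neg hlt.not_ge, if_pos le_rfl, mul_zero, mul_one]
    exact (stdSimplex.zero_le t i).lt_of_ne' hi
  rw [← sum_stdSimplex_map_mul f t fun b => if b ≤ f i then 1 else 0, h,
    sum_stdSimplex_map_mul] at hstrict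
  exact hstrict.false

theorem eq_of_stdSimplex_map_eq {ι κ : Type*} [Fintype ι] [LinearOrder ι] [Fintype κ]
    [LinearOrder κ] {f g : ι → κ} (hf : Monotone f) (hg : Monotone g) {t : stdSimplex ℝ ι}
    (h : stdSimplex.map f t = stdSimplex.map g t) {i : ι} (hi : t i ≠ 0) : f i = g i :=
  (le_of_stdSimplex_map_eq hg hf h.symm hi).antisymm (le_of_stdSimplex_map_eq hf hg h hi)

/-- The weights `a` and `b` are pushforwards, along monotone maps, of a common nonnegative weight
on a chain of length `m`. -/
def MonotoneCoupled (m : ℕ) {k l : ℕ} (a : Fin (k + 1) → ℝ) (b : Fin (l + 1) → ℝ) : Prop :=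
  ∃ (w : Fin (m + 1) → ℝ) (f : Fin (m + 1) →o Fin (k + 1)) (g : Fin (m + 1) →o Fin (l + 1)),
    0 ≤ w ∧ (∀ u : Fin (k + 1) → ℝ, ∑ i, w i * u (f i) = ∑ i, a i * u i) ∧
      ∀ v : Fin (l + 1) → ℝ, ∑ i, w i * v (g i) = ∑ j, b j * v j

theorem MonotoneCoupled.symm {m k l : ℕ} {a : Fin (k + 1) → ℝ} {b : Fin (l + 1) → ℝ}
    (h : MonotoneCoupled m a b) : MonotoneCoupled m b a :=
  let ⟨w, f, g, hw, hf, hg⟩ := h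
  ⟨w, g, f, hw, hg, hf⟩

theorem monotoneCoupled_of_sum_eq {l : ℕ} {a : Fin 1 → ℝ} {b : Fin (l + 1) → ℝ} (hb : 0 ≤ b)
    (hab : ∑ i, a i = ∑ j, b j) : MonotoneCoupled l a b := by
  refine ⟨b, ⟨fun _ => 0, monotone_const⟩, OrderHom.id, hb, fun u => ?_, fun _ => rfl⟩
  rw [Fin.sum_univ_one] at hab ⊢
  rw [hab, Finset.sum_mul]
  rfl

theorem MonotoneCoupled.cons {m k l : ℕ} {a : Fin (k + 2) → ℝ} {b : Fin (l + 1) → ℝ}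
    (ha : 0 ≤ a 0)
    (h : MonotoneCoupled m (Fin.tail a) (Function.update b 0 (b 0 - a 0))) :
    MonotoneCoupled (m + 1) a b := by
  obtain ⟨w, f, g, hw, hf, hg⟩ := h
  refine ⟨Fin.cons (a 0) w, ⟨Fin.cons 0 fun i => (f i).succ, ?_⟩, ⟨Fin.cons 0 g, ?_⟩, ?_,
    fun u => ?_, fun v => ?_⟩
  · exact Fin.cases (fun j _ => Fin.zero_le _) fun i => Fin.cases
      (fun hi => absurd hi (Fin.succ_pos i).not_ge)
      fun j hij => Fin.succ_le_succ_iff.2 (f.monotone (Fin.succ_le_succ_iff.1 hij))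
  · exact Fin.cases (fun j _ => Fin.zero_le _) fun i => Fin.cases
      (fun hi => absurd hi (Fin.succ_pos i).not_ge)
      fun j hij => g.monotone (Fin.succ_le_succ_iff.1 hij)
  · exact Fin.cases ha hw
  · rw [Fin.sum_univ_succ, Fin.sum_univ_succ fun i => a i * u i]
    exact congrArg (a 0 * u 0 + ·) (hf fun i => u i.succ)
  · have hupd := hg v
    rw [Fin.sum_univ_succ fun j => Function.update b 0 (b 0 - a 0) j * v j] at hupd
    simp only [Function.update_self, Function.update_of_ne (Fin.succ_ne_zero _)] at hupd
    rw [Fin.sum_univ_succ, Fin.sum_univ_succ fun j => b j * v j]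
    change a 0 * v 0 + ∑ i, w i * v (g i) = _
    linear_combination hupd

-- The north-west corner rule of transport theory.
theorem monotoneCoupled_of_add_eq {m k l : ℕ} (hm : k + l = m) {a : Fin (k + 1) → ℝ}
    {b : Fin (l + 1) → ℝ} (ha : 0 ≤ a) (hb : 0 ≤ b) (hab : ∑ i, a i = ∑ j, b j) :
    MonotoneCoupled m a b := by
  induction m generalizing k l with
  | zero =>
    obtain ⟨rfl, rfl⟩ : k = 0 ∧ l = 0 := by omega
    exact monotoneCoupled_of_sum_eq hb hab
  | succ m ih =>
    rcases k with _ | k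
    · obtain rfl : l = m + 1 := by omega
      exact monotoneCoupled_of_sum_eq hb hab
    rcases l with _ | l
    · obtain rfl : k = m := by omega
      exact (monotoneCoupled_of_sum_eq ha hab.symm).symm
    wlog hle : a 0 ≤ b 0 generalizing k l a b
    · exact (this l hb k ha (by omega) hab.symm (le_of_not_ge hle)).symm
    refine .cons (ha 0) (ih (by omega) (fun i => ha i.succ) (fun j => ?_) ?_)
    · rcases eq_or_ne j 0 with rfl | hj
      · rw [Function.update_self]
        exact sub_nonneg.2 hle
      · rw [Function.update_of_ne hj]
        exact hb j
    · rw [Fin.sum_univ_succ, Fin.sum_univ_succ b] at hab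
      rw [Fin.sum_univ_succ (Function.update b 0 _)]
      simp only [Function.update_self, Function.update_of_ne (Fin.succ_ne_zero _), Fin.tail]
      linarith

theorem exists_simpMap_eq_simpMap_eq {k l : SimplexCategory} (t : Simp k) (s : Simp l) :
    ∃ (f : ⦋k.len + l.len⦌ ⟶ k) (g : ⦋k.len + l.len⦌ ⟶ l) (w : Simp ⦋k.len + l.len⦌),
      simpMap f w = t ∧ simpMap g w = s := by
  obtain ⟨w, f, g, hw, hf, hg⟩ := monotoneCoupled_of_add_eq rfl (stdSimplex.zero_le t)
    (stdSimplex.zero_le s) ((stdSimplex.sum_eq_one t).trans (stdSimplex.sum_eq_one s).symm)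
  have hsum : ∑ i, w i = 1 := by
    simpa only [mul_one, stdSimplex.sum_eq_one] using hf fun _ => 1
  refine ⟨SimplexCategory.Hom.mk f, SimplexCategory.Hom.mk g, ⟨w, hw, hsum⟩, ?_, ?_⟩
  · exact stdSimplex_ext_of_sum_mul fun u => (sum_stdSimplex_map_mul _ _ _).trans (hf u)
  · exact stdSimplex_ext_of_sum_mul fun u => (sum_stdSimplex_map_mul _ _ _).trans (hg u)

end Coupling

/-! ### Simplicial homotopies and geometric realization -/

section RealizationHomotopy

open MonoidalCategory

variable {X Y : SSet.{u}}

theorem simpMap_comp {j k l : SimplexCategory} (θ : j ⟶ k) (η : k ⟶ l) (t : Simp j) :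
    simpMap (θ ≫ η) t = simpMap η (simpMap θ t) :=
  (stdSimplex.map_comp_apply θ η t).symm

/-- The simplex `(f^* x, g^* y)` of `X ⊗ Y`. -/
def jointSimplex {m k l : SimplexCategory} (x : X.obj (op k)) (y : Y.obj (op l)) (f : m ⟶ k)
    (g : m ⟶ l) : (X ⊗ Y).obj (op m) :=
  (X.map f.op x, Y.map g.op y)

theorem map_jointSimplex {j m k l : SimplexCategory} (x : X.obj (op k)) (y : Y.obj (op l))
    (θ : j ⟶ m) (f : m ⟶ k) (g : m ⟶ l) :
    (X ⊗ Y).map θ.op (jointSimplex x y f g) = jointSimplex x y (θ ≫ f) (θ ≫ g) := by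
  simp only [jointSimplex, op_comp, X.map_comp, Y.map_comp]
  rfl

theorem charMap_jointSimplex_simpMap {j m k l : SimplexCategory} (x : X.obj (op k))
    (y : Y.obj (op l)) (θ : j ⟶ m) (f : m ⟶ k) (g : m ⟶ l) (w : Simp j) :
    charMap (jointSimplex x y f g) (simpMap θ w) =
      charMap (jointSimplex x y (θ ≫ f) (θ ≫ g)) w := by
  rw [← charMap_map, map_jointSimplex]

theorem charMap_jointSimplex_eq {m k l : SimplexCategory} {f f' : m ⟶ k} {g g' : m ⟶ l}
    (x : X.obj (op k)) (y : Y.obj (op l)) {w : Simp m} (hf : simpMap f w = simpMap f' w)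
    (hg : simpMap g w = simpMap g' w) :
    charMap (jointSimplex x y f g) w = charMap (jointSimplex x y f' g') w := by
  obtain ⟨ρ, hρ, hρw⟩ := exists_orderHom_map_eq_self w
  have hcomp {n : SimplexCategory} {e e' : m ⟶ n} (he : simpMap e w = simpMap e' w) :
      SimplexCategory.Hom.mk ρ ≫ e = SimplexCategory.Hom.mk ρ ≫ e' :=
    SimplexCategory.Hom.ext _ _ <| OrderHom.ext _ _ <| funext fun a =>
      eq_of_stdSimplex_map_eq e.toOrderHom.monotone e'.toOrderHom.monotone he (hρ a)
  replace hρw : simpMap (SimplexCategory.Hom.mk ρ) w = w := hρw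
  rw [← hρw, charMap_jointSimplex_simpMap, charMap_jointSimplex_simpMap, hcomp hf, hcomp hg]

-- A coupling of `w` with `w'` refines both, which reduces to a single point.
theorem charMap_jointSimplex_eq_of_simpMap_eq {m m' k l : SimplexCategory} {f : m ⟶ k}
    {g : m ⟶ l} {f' : m' ⟶ k} {g' : m' ⟶ l} (x : X.obj (op k)) (y : Y.obj (op l))
    {w : Simp m} {w' : Simp m'} (hf : simpMap f w = simpMap f' w')
    (hg : simpMap g w = simpMap g' w') :
    charMap (jointSimplex x y f g) w = charMap (jointSimplex x y f' g') w' := by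
  obtain ⟨d, d', v, rfl, rfl⟩ := exists_simpMap_eq_simpMap_eq w w'
  rw [charMap_jointSimplex_simpMap, charMap_jointSimplex_simpMap]
  apply charMap_jointSimplex_eq <;> rwa [simpMap_comp, simpMap_comp]

theorem isQuotientMap_simpMap_prodMk (k l : SimplexCategory) :
    IsQuotientMap fun q : (_ : (⦋k.len + l.len⦌ ⟶ k) × (⦋k.len + l.len⦌ ⟶ l)) ×
      Simp ⦋k.len + l.len⦌ => (simpMap q.1.1 q.2, simpMap q.1.2 q.2) := by
  have hcont : Continuous fun q : (_ : (⦋k.len + l.len⦌ ⟶ k) × (⦋k.len + l.len⦌ ⟶ l)) ×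
      Simp ⦋k.len + l.len⦌ => (simpMap q.1.1 q.2, simpMap q.1.2 q.2) :=
    continuous_sigma fun p => (stdSimplex.continuous_map p.1).prodMk (stdSimplex.continuous_map p.2)
  refine hcont.isClosedMap.isQuotientMap hcont fun p => ?_
  obtain ⟨f, g, w, hf, hg⟩ := exists_simpMap_eq_simpMap_eq p.1 p.2
  exact ⟨⟨(f, g), w⟩, Prod.ext hf hg⟩

theorem exists_pairing {k l : SimplexCategory} (x : X.obj (op k)) (y : Y.obj (op l)) :
    ∃ Φ : C(Simp k × Simp l, |X ⊗ Y|), ∀ {m : SimplexCategory} (f : m ⟶ k) (g : m ⟶ l)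
      (w : Simp m), Φ (simpMap f w, simpMap g w) =
        charMap (jointSimplex x y f g) w := by
  choose f g w hf hg using fun p : Simp k × Simp l => exists_simpMap_eq_simpMap_eq p.1 p.2
  let Φ : Simp k × Simp l → |X ⊗ Y| := fun p =>
    charMap (jointSimplex x y (f p) (g p)) (w p)
  have hΦ {m : SimplexCategory} (f' : m ⟶ k) (g' : m ⟶ l) (v : Simp m) :
      Φ (simpMap f' v, simpMap g' v) =
        charMap (jointSimplex x y f' g') v :=
    charMap_jointSimplex_eq_of_simpMap_eq x y (hf _) (hg _)
  refine ⟨⟨Φ, (isQuotientMap_simpMap_prodMk k l).continuous_iff.2 (continuous_sigma fun p => ?_)⟩,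
    hΦ⟩
  exact (charMap _).continuous.congr fun v => (hΦ p.1 p.2 v).symm

/-- The map `Δᵏ × Δˡ → |X ⊗ Y|` induced by a `k`-simplex `x` of `X` and an `l`-simplex `y` of `Y`.
It takes a pair of points to the image, under the characteristic map of the corresponding
simplex of `X ⊗ Y`, of any common refinement of the two points. -/
def pairing {k l : SimplexCategory} (x : X.obj (op k)) (y : Y.obj (op l)) :
    C(Simp k × Simp l, |X ⊗ Y|) :=
  (exists_pairing x y).choose

theorem pairing_simpMap {m k l : SimplexCategory} (x : X.obj (op k)) (y : Y.obj (op l))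
    (f : m ⟶ k) (g : m ⟶ l) (w : Simp m) :
    pairing x y (simpMap f w, simpMap g w) =
      charMap (jointSimplex x y f g) w :=
  (exists_pairing x y).choose_spec f g w

theorem pairing_map_left {j k l : SimplexCategory} (θ : j ⟶ k) (x : X.obj (op k))
    (y : Y.obj (op l)) (t : Simp j) (s : Simp l) :
    pairing (X.map θ.op x) y (t, s) = pairing x y (simpMap θ t, s) := by
  obtain ⟨f, g, w, rfl, rfl⟩ := exists_simpMap_eq_simpMap_eq t s
  rw [pairing_simpMap, ← simpMap_comp, pairing_simpMap]
  simp only [jointSimplex, op_comp, X.map_comp]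
  rfl

theorem exists_toTop_pairing {l : SimplexCategory} (y : Y.obj (op l)) :
    ∃ Φ : C(|X| × Simp l, |X ⊗ Y|), ∀ {k : SimplexCategory} (x : X.obj (op k)) (t : Simp k)
      (s : Simp l), Φ (charMap x t, s) = pairing x y (t, s) := by
  obtain ⟨Ψ, hΨ⟩ := exists_toTop_desc (X := X) (T := TopCat.of C(Simp l, |X ⊗ Y|))
    (fun x => (pairing x y).curry)
    (fun θ x t => ContinuousMap.ext fun s => pairing_map_left θ x y t s)
  refine ⟨ContinuousMap.uncurry Ψ.hom, fun x t s => ?_⟩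
  exact DFunLike.congr_fun (hΨ x t) s

theorem simpMap_const {k l : SimplexCategory} (t : Simp k) (i : Fin (l.len + 1)) :
    simpMap (SimplexCategory.Hom.mk (OrderHom.const _ i) : k ⟶ l) t = stdSimplex.vertex i := by
  refine stdSimplex_ext_of_sum_mul fun u => (sum_stdSimplex_map_mul _ t u).trans ?_
  change ∑ a, t a * u i = ∑ b, (Pi.single i 1 : Fin (l.len + 1) → ℝ) b * u b
  rw [← Finset.sum_mul, stdSimplex.sum_eq_one, one_mul, Fintype.sum_eq_single i fun b hb => by
    rw [Pi.single_eq_of_ne hb, zero_mul], Pi.single_eq_same, one_mul]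

theorem pairing_vertex {k l : SimplexCategory} (x : X.obj (op k)) (y : Y.obj (op l))
    (t : Simp k) (i : Fin (l.len + 1)) :
    pairing x y (t, stdSimplex.vertex i) =
      charMap (jointSimplex x y (𝟙 k) (SimplexCategory.Hom.mk (OrderHom.const _ i))) t := by
  rw [← pairing_simpMap, simpMap_const]
  exact congrArg (fun s => pairing x y (s, _)) (stdSimplex.map_id_apply t).symm

theorem homotopic_toTop_map_ι₀_ι₁ (X : SSet.{u}) :
    ContinuousMap.Homotopic (SSet.toTop.map (SSet.ι₀ (X := X))).hom
      (SSet.toTop.map (SSet.ι₁ (X := X))).hom := by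
  obtain ⟨Φ, hΦ⟩ := exists_toTop_pairing (X := X) (Y := Δ[1]) (l := ⦋1⦌) (SSet.yonedaEquiv (𝟙 _))
  have hend {ι : X ⟶ X ⊗ Δ[1]} {i : Fin 2} (hι : ∀ {k : SimplexCategory} (x : X.obj (op k)),
      ι.app (op k) x = jointSimplex x (SSet.yonedaEquiv (𝟙 Δ[1])) (𝟙 k)
        (SimplexCategory.Hom.mk (OrderHom.const _ i))) (p : |X|) :
      Φ (p, stdSimplex.vertex i) = SSet.toTop.map ι p := by
    let Φᵢ : |X| ⟶ |X ⊗ Δ[1]| :=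
      TopCat.ofHom (Φ.comp (.prodMk (.id |X|) (.const |X| (stdSimplex.vertex i))))
    have heq : Φᵢ = SSet.toTop.map ι := toTop_hom_ext fun x t => by
      rw [toTop_map_charMap, hι, ← pairing_vertex]
      exact hΦ x t _
    exact ConcreteCategory.congr_hom heq p
  have hι₀ {k : SimplexCategory} (x : X.obj (op k)) : SSet.ι₀.app (op k) x =
      jointSimplex x (SSet.yonedaEquiv (𝟙 Δ[1])) (𝟙 k)
        (SimplexCategory.Hom.mk (OrderHom.const _ 0)) := by
    rw [jointSimplex, op_id, X.map_id]
    rfl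
  have hι₁ {k : SimplexCategory} (x : X.obj (op k)) : SSet.ι₁.app (op k) x =
      jointSimplex x (SSet.yonedaEquiv (𝟙 Δ[1])) (𝟙 k)
        (SimplexCategory.Hom.mk (OrderHom.const _ 1)) := by
    rw [jointSimplex, op_id, X.map_id]
    rfl
  refine ⟨⟨Φ.comp ⟨fun p => (p.2, stdSimplexHomeomorphUnitInterval.symm p.1), by fun_prop⟩,
    fun p => ?_, fun p => ?_⟩⟩
  · refine Eq.trans (congrArg (fun s => Φ (p, s)) ?_) (hend hι₀ p)
    exact (Homeomorph.symm_apply_eq _).2 stdSimplexHomeomorphUnitInterval_zero.symm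
  · refine Eq.trans (congrArg (fun s => Φ (p, s)) ?_) (hend hι₁ p)
    exact (Homeomorph.symm_apply_eq _).2 stdSimplexHomeomorphUnitInterval_one.symm

theorem homotopic_toTop_map {X Y : SSet.{u}} (H : X ⊗ Δ[1] ⟶ Y) :
    ContinuousMap.Homotopic (SSet.toTop.map (SSet.ι₀ ≫ H)).hom
      (SSet.toTop.map (SSet.ι₁ ≫ H)).hom := by
  rw [Functor.map_comp, Functor.map_comp]
  exact (ContinuousMap.Homotopic.refl _).comp (homotopic_toTop_map_ι₀_ι₁ X)

end RealizationHomotopy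

/-! ### Homotopy groups of contractible spaces -/

section Cube

open unitInterval

variable {N : Type*}

/-- The expansion of the cube about its centre by a factor `2`, clamped to the cube. It pushes the
outer half of the cube into the boundary. -/
def cubeExpand (y : I^N) : I^N :=
  fun i => Set.projIcc (0 : ℝ) 1 zero_le_one (2 * (y i : ℝ) - 1 / 2)

/-- A function on the cube which vanishes on the boundary and is `1` wherever `cubeExpand` does not
take values in the boundary. -/
def cubeBump [Fintype N] (y : I^N) : I :=
  ∏ i, Set.projIcc (0 : ℝ) 1 zero_le_one (4 * min (y i : ℝ) (1 - y i))

/-- The straight line in the cube from `y` to `cubeExpand y`. -/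
def cubeLine (s : I) (y : I^N) : I^N :=
  fun i => Set.projIcc (0 : ℝ) 1 zero_le_one
    ((1 - (s : ℝ)) * (y i : ℝ) + (s : ℝ) * (cubeExpand y i : ℝ))

theorem continuous_cubeExpand : Continuous (cubeExpand (N := N)) :=
  continuous_pi fun i => continuous_projIcc.comp (by fun_prop)

theorem continuous_cubeBump [Fintype N] : Continuous (cubeBump (N := N)) :=
  continuous_finsetProd _ fun i _ => continuous_projIcc.comp (by fun_prop)

theorem continuous_cubeLine : Continuous (fun p : I × (I^N) => cubeLine p.1 p.2) := by
  refine continuous_pi fun i => continuous_projIcc.comp ?_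
  have : Continuous (fun p : I × (I^N) => cubeExpand p.2 i) :=
    (continuous_apply i).comp (continuous_cubeExpand.comp continuous_snd)
  fun_prop

theorem cubeLine_zero (y : I^N) : cubeLine 0 y = y := by
  funext i
  simp [cubeLine]

theorem cubeLine_one (y : I^N) : cubeLine 1 y = cubeExpand y := by
  funext i
  simp [cubeLine]

theorem cubeBump_of_mem_boundary [Fintype N] {y : I^N} (hy : y ∈ Cube.boundary N) :
    cubeBump y = 0 := by
  obtain ⟨i, hi⟩ := hy
  refine Finset.prod_eq_zero (Finset.mem_univ i) (Set.projIcc_of_le_left _ ?_)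
  rcases hi with hi | hi <;> simp [hi]

theorem cubeLine_mem_boundary (s : I) {y : I^N} (hy : y ∈ Cube.boundary N) :
    cubeLine s y ∈ Cube.boundary N := by
  obtain ⟨i, hi⟩ := hy
  refine ⟨i, ?_⟩
  rcases hi with hi | hi
  · left
    have hexp : cubeExpand y i = 0 := Set.projIcc_of_le_left _ (by simp [hi])
    simp [cubeLine, hi, hexp]
  · right
    have hexp : cubeExpand y i = 1 :=
      Set.projIcc_of_right_le _ (by rw [hi, Set.Icc.coe_one]; norm_num)
    simp [cubeLine, hi, hexp]

theorem cubeBump_eq_one_or_cubeExpand_mem_boundary [Fintype N] (y : I^N) :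
    cubeBump y = 1 ∨ cubeExpand y ∈ Cube.boundary N := by
  by_cases h : ∀ i, 1 ≤ 4 * min (y i : ℝ) (1 - y i)
  · exact Or.inl (Finset.prod_eq_one fun i _ => Set.projIcc_of_right_le _ (h i))
  · push Not at h
    obtain ⟨i, hi⟩ := h
    refine Or.inr ⟨i, ?_⟩
    rcases le_total (y i : ℝ) (1 - y i) with hle | hle
    · rw [min_eq_left hle] at hi
      exact Or.inl (Set.projIcc_of_le_left _ (by linarith))
    · rw [min_eq_right hle] at hi
      exact Or.inr (Set.projIcc_of_right_le _ (by linarith))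

/- Contract the image of the outer half of the cube to `x` and then let the contraction run along
the bump function: the result is independent of `f`, because the bump function has reached the end
of the contraction wherever `f` still matters. -/
theorem homotopicRel_contraction [Fintype N] {T : Type*} [TopologicalSpace T] {c x : T}
    (H : (ContinuousMap.id T).Homotopy (ContinuousMap.const T c)) (f : GenLoop N T x) :
    f.1.HomotopicRel ((H : C(I × T, T)).comp (.prodMk ⟨cubeBump, continuous_cubeBump⟩ (.const _ x)))
      (Cube.boundary N) := by
  have hbump := continuous_cubeBump (N := N)
  have hline := continuous_cubeLine (N := N)
  have hf := f.1.continuous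
  refine ⟨⟨⟨⟨fun p => H (p.1 * cubeBump p.2, f.1 (cubeLine p.1 p.2)), by fun_prop⟩,
    fun y => ?_, fun y => ?_⟩, fun s y hy => ?_⟩⟩
  · change H (0 * cubeBump y, f.1 (cubeLine 0 y)) = f.1 y
    rw [zero_mul, cubeLine_zero, H.apply_zero]
    rfl
  · change H (1 * cubeBump y, f.1 (cubeLine 1 y)) = H (cubeBump y, x)
    rw [one_mul, cubeLine_one]
    rcases cubeBump_eq_one_or_cubeExpand_mem_boundary y with h | h
    · rw [h, H.apply_one, H.apply_one]
      rfl
    · rw [f.2 _ h]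
  · change H (s * cubeBump y, f.1 (cubeLine s y)) = f.1 y
    rw [cubeBump_of_mem_boundary hy, mul_zero, H.apply_zero, f.2 _ hy,
      f.2 _ (cubeLine_mem_boundary s hy)]
    rfl

theorem subsingleton_homotopyGroup_of_contractibleSpace [Finite N] (T : Type*)
    [TopologicalSpace T] [ContractibleSpace T] (x : T) : Subsingleton (HomotopyGroup N T x) := by
  have := Fintype.ofFinite N
  obtain ⟨c, ⟨H⟩⟩ := id_nullhomotopic T
  refine ⟨Quotient.ind₂ fun f g => Quotient.sound ?_⟩
  exact (homotopicRel_contraction H f).trans (homotopicRel_contraction H g).symm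

end Cube

/-! ### Trivial fibrations -/

section TrivialFibration

open MonoidalCategory

/-- Trivial fibrations of simplicial sets: the maps with the right lifting property against the
inclusions `∂Δ[k] ⟶ Δ[k]`. -/
abbrev IsTrivFib {Y Z : SSet.{u}} (p : Y ⟶ Z) : Prop := SSet.modelCategoryQuillen.I.{u}.rlp p

theorem IsTrivFib.hasLiftingProperty {Y Z : SSet.{u}} {p : Y ⟶ Z} (hp : IsTrivFib p)
    {A B : SSet.{u}} (i : A ⟶ B) [Mono i] : HasLiftingProperty i p := by
  rw [IsTrivFib, ← SSet.rlp_monomorphisms] at hp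
  exact hp i (MorphismProperty.monomorphisms.infer_property i)

/-- The disjoint union of two copies of `A`, the source of the inclusion of the two ends of the
cylinder `A ⊗ Δ[1]`. -/
def twoCopies (A : SSet.{u}) : SSet.{u} where
  obj k := A.obj k × Bool
  map θ := TypeCat.ofHom fun p => (A.map θ p.1, p.2)
  map_id k := by ext p <;> simp
  map_comp θ η := by ext p <;> simp

/-- The inclusion of both ends of the cylinder `A ⊗ Δ[1]`. -/
def twoCopiesIncl (A : SSet.{u}) : twoCopies A ⟶ A ⊗ Δ[1] where
  app k := TypeCat.ofHom fun p => if p.2 then SSet.ι₁.app k p.1 else SSet.ι₀.app k p.1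
  naturality k l θ := by
    ext ⟨a, b⟩
    cases b
    · exact ConcreteCategory.congr_hom (SSet.ι₀.naturality θ) a
    · exact ConcreteCategory.congr_hom (SSet.ι₁.naturality θ) a

instance mono_twoCopiesIncl (A : SSet.{u}) : Mono (twoCopiesIncl A) := by
  have happ (k) : Mono ((twoCopiesIncl A).app k) := by
    rw [mono_iff_injective]
    rintro ⟨a, b⟩ ⟨a', b'⟩ h
    have hfst := congrArg Prod.fst h
    have hend := congrArg (fun q => SSet.stdSimplex.asOrderHom q.2 0) h
    cases b <;> cases b'
    · exact Prod.ext hfst rfl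
    · exact absurd (show (0 : Fin 2) = 1 from hend) zero_ne_one
    · exact absurd (show (1 : Fin 2) = 0 from hend) one_ne_zero
    · exact Prod.ext hfst rfl
  exact NatTrans.mono_of_mono_app _

theorem IsTrivFib.exists_homotopy {A Y Z : SSet.{u}} {p : Y ⟶ Z} (hp : IsTrivFib p)
    {f g : A ⟶ Y} (hfg : f ≫ p = g ≫ p) :
    ∃ H : A ⊗ Δ[1] ⟶ Y, SSet.ι₀ ≫ H = f ∧ SSet.ι₁ ≫ H = g := by
  have := hp.hasLiftingProperty (twoCopiesIncl A)
  let fg : twoCopies A ⟶ Y :=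
    { app := fun k => TypeCat.ofHom fun q => if q.2 then g.app k q.1 else f.app k q.1
      naturality := fun k l θ => by
        ext ⟨a, b⟩
        cases b
        · exact ConcreteCategory.congr_hom (f.naturality θ) a
        · exact ConcreteCategory.congr_hom (g.naturality θ) a }
  have sq : CommSq fg (twoCopiesIncl A) p (CartesianMonoidalCategory.fst A Δ[1] ≫ f ≫ p) := ⟨by
    ext k ⟨a, b⟩
    cases b
    · rfl
    · rw [hfg]; rfl⟩
  refine ⟨sq.lift, ?_, ?_⟩
  · ext k a
    exact ConcreteCategory.congr_hom (NatTrans.congr_app sq.fac_left k) ((a, false) : _ × Bool)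
  · ext k a
    exact ConcreteCategory.congr_hom (NatTrans.congr_app sq.fac_left k) ((a, true) : _ × Bool)

theorem IsTrivFib.homotopic {A Y Z : SSet.{u}} {p : Y ⟶ Z} (hp : IsTrivFib p)
    {f g : A ⟶ Y} (hfg : f ≫ p = g ≫ p) :
    ContinuousMap.Homotopic (SSet.toTop.map f).hom (SSet.toTop.map g).hom := by
  obtain ⟨H, rfl, rfl⟩ := hp.exists_homotopy hfg
  exact homotopic_toTop_map H

theorem IsTrivFib.exists_section {Y Z : SSet.{u}} {p : Y ⟶ Z} (hp : IsTrivFib p) :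
    ∃ σ : Z ⟶ Y, σ ≫ p = 𝟙 Z := by
  have := hp.hasLiftingProperty (⊥ : Z.Subcomplex).ι
  have sq : CommSq (SSet.Subcomplex.isInitialBot.to Y) (⊥ : Z.Subcomplex).ι p (𝟙 Z) :=
    ⟨SSet.Subcomplex.isInitialBot.hom_ext _ _⟩
  exact ⟨sq.lift, sq.fac_right⟩

/-- The map to the point `Δ[0]`. -/
def toPt (X : SSet.{u}) : X ⟶ Δ[0] := SSet.stdSimplex.isTerminalObj₀.from X

theorem contractibleSpace_toTop_of_isTrivFib {X : SSet.{u}} (hX : IsTrivFib (toPt X)) :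
    ContractibleSpace |X| := by
  obtain ⟨σ, -⟩ := hX.exists_section
  have h := hX.homotopic (f := 𝟙 X) (g := toPt X ≫ σ)
    (SSet.stdSimplex.isTerminalObj₀.hom_ext _ _)
  have hconst : (SSet.toTop.map (toPt X ≫ σ)).hom =
      ContinuousMap.const |X| (SSet.toTop.map σ default) := by
    rw [CategoryTheory.Functor.map_comp]
    ext y
    change SSet.toTop.map σ (SSet.toTop.map (toPt X) y) = SSet.toTop.map σ default
    rw [Subsingleton.elim (SSet.toTop.map (toPt X) y) default]
  rw [hconst, CategoryTheory.Functor.map_id] at h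
  exact (contractible_iff_id_nullhomotopic _).2 ⟨_, h⟩

theorem isWeaklyContractible_of_isTrivFib {X : SSet.{u}} (hX : IsTrivFib (toPt X)) :
    IsWeaklyContractible X :=
  have := contractibleSpace_toTop_of_isTrivFib hX
  ⟨inferInstance, fun _ x => subsingleton_homotopyGroup_of_contractibleSpace |X| x⟩

end TrivialFibration

section TrivFibSimplices

variable {X : SSet.{u}}

/-- The simplex of the boundary of `Δ[n]` given by a map to `[n]` which omits a value. -/
def bdrySimplex {m : SimplexCategory} {n : ℕ} (θ : m ⟶ ⦋n⦌) (hθ : ∃ i, ∀ a, θ a ≠ i) :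
    (∂Δ[n] : SSet.{u}).obj (op m) :=
  ⟨SSet.stdSimplex.objEquiv.symm θ, fun hs => by
    obtain ⟨i, hi⟩ := hθ
    obtain ⟨a, ha⟩ := hs i
    exact hi a ha⟩

theorem exists_eq_bdrySimplex {n : ℕ} {m : SimplexCategory} (τ : (∂Δ[n] : SSet.{u}).obj (op m)) :
    ∃ (θ : m ⟶ ⦋n⦌) (hθ : ∃ i, ∀ a, θ a ≠ i), τ = bdrySimplex θ hθ := by
  refine ⟨SSet.stdSimplex.objEquiv τ.1, ?_, rfl⟩
  have hτ : ¬ Function.Surjective (SSet.stdSimplex.asOrderHom τ.1) := τ.2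
  rw [Function.Surjective] at hτ
  push Not at hτ
  exact hτ

theorem map_bdrySimplex {l m : SimplexCategory} {n : ℕ} (η : l ⟶ m) (θ : m ⟶ ⦋n⦌)
    (hθ : ∃ i, ∀ a, θ a ≠ i) (hθ' : ∃ i, ∀ a, (η ≫ θ) a ≠ i) (b : (∂Δ[n] : SSet.{u}) ⟶ X) :
    b.app _ (bdrySimplex (η ≫ θ) hθ') = X.map η.op (b.app _ (bdrySimplex θ hθ)) :=
  ConcreteCategory.congr_hom (b.naturality η.op) (bdrySimplex θ hθ)

theorem isTrivFib_toPt_of_exists_extension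
    (H : ∀ (n : ℕ) (b : (∂Δ[n] : SSet.{u}) ⟶ X), ∃ x : X.obj (op ⦋n⦌),
      ∀ {m : SimplexCategory} (θ : m ⟶ ⦋n⦌) (hθ : ∃ i, ∀ a, θ a ≠ i),
        X.map θ.op x = b.app _ (bdrySimplex θ hθ)) : IsTrivFib (toPt X) := by
  rintro _ _ _ ⟨n⟩
  refine ⟨fun {b _} _ => ?_⟩
  obtain ⟨x, hx⟩ := H n b
  refine ⟨⟨⟨SSet.yonedaEquiv.symm x, ?_, SSet.stdSimplex.isTerminalObj₀.hom_ext _ _⟩⟩⟩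
  ext k τ
  obtain ⟨θ, hθ, rfl⟩ := exists_eq_bdrySimplex (m := k.unop) τ
  exact hx θ hθ

end TrivFibSimplices

/-! ### The universal space of a simplicial group -/

section EGContractible

/-- The equations are solved one after the other, in order of decreasing `D`. -/
theorem exists_forall_map_eq {A ι : Type*} [Group A] [Finite ι] (D : ι → ℕ)
    (g : ι → A →* A) (a : ι → A) (hga : ∀ i, g i (a i) = a i) (hgg : ∀ i y, g i (g i y) = g i y)
    (hcomp : ∀ i i', i ≠ i' → D i ≤ D i' → ∀ y, g i' (g i y) = g i' (g i (g i' y)))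
    (hcompat : ∀ i i', i ≠ i' → D i ≤ D i' → g i' (g i (a i')) = g i' (a i)) :
    ∃ y, ∀ i, g i y = a i := by
  classical
  have := Fintype.ofFinite ι
  suffices H : ∀ s : Finset ι, ∃ y, ∀ i ∈ s, g i y = a i by
    obtain ⟨y, hy⟩ := H Finset.univ
    exact ⟨y, fun i => hy i (Finset.mem_univ i)⟩
  intro s
  induction s using Finset.induction_on_max_value (fun i => OrderDual.toDual (D i)) with
  | empty => exact ⟨1, by simp⟩
  | insert i s his hmax ih =>
    obtain ⟨y, hy⟩ := ih
    refine ⟨y * (g i y)⁻¹ * a i, fun i' hi' => ?_⟩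
    rcases Finset.mem_insert.1 hi' with rfl | hi'
    · rw [map_mul, map_mul, map_inv, hgg, hga, mul_inv_cancel, one_mul]
    · have hne : i ≠ i' := fun h => his (h ▸ hi')
      have hD : D i ≤ D i' := hmax i' hi'
      rw [map_mul, map_mul, map_inv, hcomp i i' hne hD, hy i' hi', hcompat i i' hne hD,
        inv_mul_cancel_right]

section MoveHom

variable {n : ℕ} {j i : Fin (n + 1)}

/-- The neighbour of `i` in the direction of `j`. -/
def moveTo (j i : Fin (n + 1)) : Fin (n + 1) :=
  if h : i < j then ⟨i + 1, by have := j.2; have : (i : ℕ) < j := h; omega⟩ else ⟨i - 1, by omega⟩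

theorem moveTo_ne (hij : i ≠ j) : moveTo j i ≠ i := by
  have hij' : (i : ℕ) ≠ j := fun h => hij (Fin.ext h)
  simp only [moveTo, Fin.lt_def, ne_eq, Fin.ext_iff]
  split_ifs <;> dsimp only <;> omega

/-- The monotone map which moves `i` one step towards `j` and fixes all other elements: the
idempotent of `[n]` that factors through the `i`-th face and fixes `j`. -/
def moveHom (j i : Fin (n + 1)) (hij : i ≠ j) : (⦋n⦌ : SimplexCategory) ⟶ ⦋n⦌ :=
  SimplexCategory.Hom.mk
    { toFun := fun m => if m = i then moveTo j i else m
      monotone' := fun a b hab => by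
        have hab' : (a : ℕ) ≤ b := hab
        have : (i : ℕ) ≠ j := fun h => hij (Fin.ext h)
        rw [Fin.le_def]
        simp only [moveTo, Fin.ext_iff, Fin.lt_def]
        split_ifs <;> simp <;> omega }

theorem moveHom_apply (hij : i ≠ j) (m : Fin (n + 1)) :
    moveHom j i hij m = if m = i then moveTo j i else m := rfl

theorem moveHom_ne (hij : i ≠ j) (m : Fin (n + 1)) : moveHom j i hij m ≠ i := by
  rw [moveHom_apply]
  split_ifs with hm
  · exact moveTo_ne hij
  · exact hm

theorem moveHom_of_ne (hij : i ≠ j) {m : Fin (n + 1)} (hm : m ≠ i) : moveHom j i hij m = m :=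
  if_neg hm

theorem comp_moveHom (hij : i ≠ j) {m : SimplexCategory} {θ : m ⟶ ⦋n⦌} (hθ : ∀ a, θ a ≠ i) :
    θ ≫ moveHom j i hij = θ := by
  ext a : 3
  exact moveHom_of_ne hij (hθ a)

theorem moveHom_comp_moveHom_ne {i' : Fin (n + 1)} (hij : i ≠ j) (hij' : i' ≠ j)
    (hD : Nat.dist i j ≤ Nat.dist i' j) (a : Fin (n + 1)) :
    (moveHom j i' hij' ≫ moveHom j i hij) a ≠ i' := by
  change moveHom j i hij (moveHom j i' hij' a) ≠ i'
  rw [moveHom_apply hij]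
  split_ifs
  · rintro rfl
    have hij'' : (i : ℕ) ≠ j := fun h => hij (Fin.ext h)
    revert hD
    simp only [moveTo, Fin.lt_def, Nat.dist]
    split_ifs <;> simp <;> omega
  · exact moveHom_ne hij' a

end MoveHom

variable {G : SimplicialObject GrpCat.{u}} {n : ℕ}

/-- The `a`-th entry of a simplex of the boundary of an `n`-simplex of `EG`. -/
def bdryEntry (b : (∂Δ[n] : SSet.{u}) ⟶ EG G) {m : SimplexCategory} (θ : m ⟶ ⦋n⦌)
    (hθ : ∃ i, ∀ a, θ a ≠ i) (a : Fin (m.len + 1)) : G.obj (op m) :=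
  (show Fin (m.len + 1) → G.obj (op m) from b.app _ (bdrySimplex θ hθ)) a

theorem bdryEntry_comp (b : (∂Δ[n] : SSet.{u}) ⟶ EG G) {l m : SimplexCategory} (η : l ⟶ m)
    {θ : m ⟶ ⦋n⦌} (hθ : ∃ i, ∀ a, θ a ≠ i) {θ' : l ⟶ ⦋n⦌} (hθ' : ∃ i, ∀ a, θ' a ≠ i)
    (h : η ≫ θ = θ') (a : Fin (l.len + 1)) :
    G.map η.op (bdryEntry b θ hθ (η a)) = bdryEntry b θ' hθ' a := by
  subst h
  exact (congrFun (map_bdrySimplex η θ hθ hθ' b) a).symm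

theorem map_op_map_op {k l m : SimplexCategory} (η : k ⟶ l) (θ : l ⟶ m) (y : G.obj (op m)) :
    G.map η.op (G.map θ.op y) = G.map (η ≫ θ).op y := by
  rw [op_comp, G.map_comp]
  rfl

theorem exists_map_moveHom_eq_bdryEntry (b : (∂Δ[n] : SSet.{u}) ⟶ EG G) (j : Fin (n + 1)) :
    ∃ y : G.obj (op ⦋n⦌), ∀ (i : Fin (n + 1)) (hij : i ≠ j),
      G.map (moveHom j i hij).op y = bdryEntry b (moveHom j i hij) ⟨i, moveHom_ne hij⟩ j := by
  have hmap (i : {i // i ≠ j}) (θ : ⦋n⦌ ⟶ ⦋n⦌) (hθj : θ j = j) {θ' : ⦋n⦌ ⟶ ⦋n⦌}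
      (hθ' : ∃ a, ∀ c, θ' c ≠ a) (h : θ ≫ moveHom j i i.2 = θ') :
      G.map θ.op (bdryEntry b (moveHom j i i.2) ⟨i, moveHom_ne i.2⟩ j) = bdryEntry b θ' hθ' j := by
    rw [← bdryEntry_comp b θ ⟨i, moveHom_ne i.2⟩ hθ' h, hθj]
  have hfix (i : {i // i ≠ j}) : moveHom j i i.2 j = j := moveHom_of_ne i.2 i.2.symm
  have hidem (i : {i // i ≠ j}) : moveHom j i i.2 ≫ moveHom j i i.2 = moveHom j i i.2 :=
    comp_moveHom i.2 (moveHom_ne i.2)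
  have habsorb (i i' : {i // i ≠ j}) (hD : Nat.dist i j ≤ Nat.dist i' j) :
      (moveHom j i' i'.2 ≫ moveHom j i i.2) ≫ moveHom j i' i'.2 =
        moveHom j i' i'.2 ≫ moveHom j i i.2 :=
    comp_moveHom i'.2 (moveHom_comp_moveHom_ne i.2 i'.2 hD)
  have hcomp (i i' : {i // i ≠ j}) (hD : Nat.dist i j ≤ Nat.dist i' j) (y : G.obj (op ⦋n⦌)) :
      G.map (moveHom j i' i'.2).op (G.map (moveHom j i i.2).op y) =
        G.map (moveHom j i' i'.2).op (G.map (moveHom j i i.2).op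
          (G.map (moveHom j i' i'.2).op y)) := by
    rw [map_op_map_op, map_op_map_op, map_op_map_op, habsorb i i' hD]
  have hcompat (i i' : {i // i ≠ j}) (hD : Nat.dist i j ≤ Nat.dist i' j) :
      G.map (moveHom j i' i'.2).op (G.map (moveHom j i i.2).op
          (bdryEntry b (moveHom j i' i'.2) ⟨i', moveHom_ne i'.2⟩ j)) =
        G.map (moveHom j i' i'.2).op (bdryEntry b (moveHom j i i.2) ⟨i, moveHom_ne i.2⟩ j) := by
    have hmiss : ∃ a, ∀ c, (moveHom j i' i'.2 ≫ moveHom j i i.2) c ≠ a :=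
      ⟨i, fun c => moveHom_ne i.2 _⟩
    have hfix' : (moveHom j i' i'.2 ≫ moveHom j i i.2) j = j := by
      change moveHom j i i.2 (moveHom j i' i'.2 j) = j
      rw [hfix, hfix]
    rw [map_op_map_op, hmap i' _ hfix' hmiss (habsorb i i' hD), hmap i _ (hfix i') hmiss rfl]
  obtain ⟨y, hy⟩ := exists_forall_map_eq (fun i : {i // i ≠ j} => Nat.dist i j)
    (fun i => (G.map (moveHom j i i.2).op).hom)
    (fun i => bdryEntry b (moveHom j i i.2) ⟨i, moveHom_ne i.2⟩ j)
    (fun i => hmap i _ (hfix i) _ (hidem i))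
    (fun i y => (map_op_map_op _ _ y).trans (by rw [hidem]))
    (fun i i' _ => hcomp i i') (fun i i' _ => hcompat i i')
  exact ⟨y, fun i hij => hy ⟨i, hij⟩⟩

theorem exists_forall_map_eq_bdryEntry (b : (∂Δ[n] : SSet.{u}) ⟶ EG G) (j : Fin (n + 1)) :
    ∃ y : G.obj (op ⦋n⦌), ∀ {m : SimplexCategory} (θ : m ⟶ ⦋n⦌) (hθ : ∃ i, ∀ a, θ a ≠ i)
      (a : Fin (m.len + 1)), θ a = j → G.map θ.op y = bdryEntry b θ hθ a := by
  obtain ⟨y, hy⟩ := exists_map_moveHom_eq_bdryEntry b j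
  refine ⟨y, fun {m} θ hθ a ha => ?_⟩
  subst ha
  obtain ⟨i, hi⟩ := hθ
  have hia : i ≠ θ a := (hi a).symm
  have hcomp := comp_moveHom hia hi
  rw [← bdryEntry_comp b θ ⟨i, moveHom_ne hia⟩ _ hcomp, ← hy i hia, map_op_map_op, hcomp]

theorem isTrivFib_EG : IsTrivFib (toPt (EG G)) := by
  refine isTrivFib_toPt_of_exists_extension fun n b => ?_
  choose y hy using exists_forall_map_eq_bdryEntry b
  exact ⟨y, fun θ hθ => funext fun a => hy (θ a) θ hθ a rfl⟩

end EGContractible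

/-! ### Quotients by free actions -/

section Quotients

open MonoidalCategory CartesianMonoidalCategory

variable {G : SimplicialObject GrpCat.{u}}

section OrbitProj

variable {P A : SSet.{u}} [SimplicialAction G P] [SimplicialAction G A]

variable (G P) in
/-- The quotient map `P ⟶ P / G`. -/
def orbitProj : P ⟶ orbitSpace G P where
  app k := TypeCat.ofHom fun x => Quotient.mk'' (s₁ := MulAction.orbitRel (G.obj k) (P.obj k)) x

theorem orbitProj_surjective (k : SimplexCategoryᵒᵖ) :
    Function.Surjective ((orbitProj G P).app k) := Quotient.mk''_surjective

instance epi_orbitProj : Epi (orbitProj G P) := by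
  have happ (k) : Epi ((orbitProj G P).app k) :=
    (epi_iff_surjective _).2 (orbitProj_surjective k)
  exact NatTrans.epi_of_epi_app _

theorem orbitProj_app_eq_iff {k : SimplexCategoryᵒᵖ} {x y : P.obj k} :
    (orbitProj G P).app k x = (orbitProj G P).app k y ↔ ∃ g : G.obj k, g • y = x :=
  Quotient.eq''

theorem orbitProj_app_smul {k : SimplexCategoryᵒᵖ} (g : G.obj k) (x : P.obj k) :
    (orbitProj G P).app k (g • x) = (orbitProj G P).app k x :=
  orbitProj_app_eq_iff.2 ⟨g, rfl⟩

theorem orbitProj_comp_orbitMap (F : P ⟶ A) (hF : IsEquivariant G F) :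
    orbitProj G P ≫ orbitMap G F hF = F ≫ orbitProj G A := rfl

variable {F : P ⟶ A}

theorem exists_orbitProj_app_eq (hF : IsEquivariant G F) {k : SimplexCategoryᵒᵖ}
    {q : (orbitSpace G P).obj k} {a : A.obj k}
    (h : (orbitMap G F hF).app k q = (orbitProj G A).app k a) :
    ∃ y : P.obj k, (orbitProj G P).app k y = q ∧ F.app k y = a := by
  obtain ⟨y, rfl⟩ := orbitProj_surjective k q
  obtain ⟨g, rfl⟩ := orbitProj_app_eq_iff.1 h.symm
  exact ⟨g • y, orbitProj_app_smul g y, hF k g y⟩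

theorem eq_of_orbitProj_app_eq (hF : IsEquivariant G F) (hA : IsLevelwiseFree G A)
    {k : SimplexCategoryᵒᵖ} {y y' : P.obj k}
    (horb : (orbitProj G P).app k y = (orbitProj G P).app k y')
    (hFy : F.app k y = F.app k y') : y = y' := by
  obtain ⟨g, rfl⟩ := orbitProj_app_eq_iff.1 horb
  rw [hF k g y'] at hFy
  rw [hA k g _ hFy, one_smul]

theorem exists_lift_orbitProj (hF : IsEquivariant G F) (hA : IsLevelwiseFree G A)
    {K : SSet.{u}} {q : K ⟶ orbitSpace G P} {a : K ⟶ A}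
    (h : q ≫ orbitMap G F hF = a ≫ orbitProj G A) :
    ∃ l : K ⟶ P, l ≫ orbitProj G P = q ∧ l ≫ F = a := by
  have hpointwise (k) (x : K.obj k) :
      ∃ y : P.obj k, (orbitProj G P).app k y = q.app k x ∧ F.app k y = a.app k x :=
    exists_orbitProj_app_eq hF (ConcreteCategory.congr_hom (NatTrans.congr_app h k) x)
  choose l hlq hla using hpointwise
  refine ⟨{ app := fun k => TypeCat.ofHom (l k), naturality := fun k k' θ => ?_ }, ?_, ?_⟩
  · refine ConcreteCategory.hom_ext _ _ fun x => eq_of_orbitProj_app_eq hF hA ?_ ?_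
    · change (orbitProj G P).app k' (l k' (K.map θ x)) =
        (orbitProj G P).app k' (P.map θ (l k x))
      rw [hlq, NatTrans.naturality_apply, NatTrans.naturality_apply, hlq]
    · change F.app k' (l k' (K.map θ x)) = F.app k' (P.map θ (l k x))
      rw [hla, NatTrans.naturality_apply, NatTrans.naturality_apply, hla]
  · ext k x
    exact hlq k x
  · ext k x
    exact hla k x

theorem isTrivFib_orbitMap (hF : IsEquivariant G F) (hA : IsLevelwiseFree G A)
    (hp : IsTrivFib F) : IsTrivFib (orbitMap G F hF) := by
  rintro _ _ _ ⟨n⟩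
  refine ⟨fun {b z} sq => ?_⟩
  have := hp.hasLiftingProperty (∂Δ[n] : (Δ[n] : SSet.{u}).Subcomplex).ι
  obtain ⟨a₀, ha₀⟩ := orbitProj_surjective (G := G) (P := A) _ (SSet.yonedaEquiv z)
  obtain ⟨a, rfl⟩ : ∃ a : Δ[n] ⟶ A, a ≫ orbitProj G A = z :=
    ⟨SSet.yonedaEquiv.symm a₀, by rw [SSet.yonedaEquiv_symm_comp, ha₀, Equiv.symm_apply_apply]⟩
  obtain ⟨b', rfl, hb'⟩ := exists_lift_orbitProj hF hA (sq.w.trans (Category.assoc _ _ _).symm)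
  have sq' : CommSq b' (∂Δ[n] : (Δ[n] : SSet.{u}).Subcomplex).ι F a := ⟨hb'⟩
  refine ⟨⟨⟨sq'.lift ≫ orbitProj G P, ?_, ?_⟩⟩⟩
  · rw [sq'.fac_left_assoc]
  · rw [Category.assoc, orbitProj_comp_orbitMap, sq'.fac_right_assoc]

end OrbitProj

theorem isRealizationEquiv_section_comp {Q Y Z : SSet.{u}} {p : Q ⟶ Y} {q : Q ⟶ Z}
    (hp : IsTrivFib p) (hq : IsTrivFib q) {σ : Y ⟶ Q} (hσ : σ ≫ p = 𝟙 Y) :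
    IsRealizationEquiv (σ ≫ q) := by
  obtain ⟨τ, hτ⟩ := hq.exists_section
  have hqτ : ContinuousMap.Homotopic (SSet.toTop.map (σ ≫ q ≫ τ)).hom (SSet.toTop.map σ).hom :=
    hq.homotopic (by simp [hτ])
  have hpσ : ContinuousMap.Homotopic (SSet.toTop.map (τ ≫ p ≫ σ)).hom (SSet.toTop.map τ).hom :=
    hp.homotopic (by simp [hσ])
  refine ⟨⟨(SSet.toTop.map (σ ≫ q)).hom, (SSet.toTop.map (τ ≫ p)).hom, ?_, ?_⟩, rfl⟩
  · have hleft := (ContinuousMap.Homotopic.refl (SSet.toTop.map p).hom).comp hqτ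
    rw [← TopCat.hom_comp, ← TopCat.hom_comp, ← CategoryTheory.Functor.map_comp,
      ← CategoryTheory.Functor.map_comp, hσ, CategoryTheory.Functor.map_id, TopCat.hom_id] at hleft
    rw [← TopCat.hom_comp, ← CategoryTheory.Functor.map_comp]
    simpa only [Category.assoc] using hleft
  · have hright := (ContinuousMap.Homotopic.refl (SSet.toTop.map q).hom).comp hpσ
    rw [← TopCat.hom_comp, ← TopCat.hom_comp, ← CategoryTheory.Functor.map_comp,
      ← CategoryTheory.Functor.map_comp, hτ, CategoryTheory.Functor.map_id, TopCat.hom_id] at hright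
    rw [← TopCat.hom_comp, ← CategoryTheory.Functor.map_comp]
    simpa only [Category.assoc] using hright

variable {A B : SSet.{u}}

theorem isTrivFib_fst (hB : IsTrivFib (toPt B)) : IsTrivFib (fst A B) := by
  rintro _ _ _ ⟨n⟩
  refine ⟨fun {b z} sq => ?_⟩
  have := hB.hasLiftingProperty (∂Δ[n] : (Δ[n] : SSet.{u}).Subcomplex).ι
  have sq' : CommSq (b ≫ snd A B) (∂Δ[n] : (Δ[n] : SSet.{u}).Subcomplex).ι (toPt B) (toPt _) :=
    ⟨SSet.stdSimplex.isTerminalObj₀.hom_ext _ _⟩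
  refine ⟨⟨⟨lift z sq'.lift, ?_, lift_fst _ _⟩⟩⟩
  rw [comp_lift, ← sq.w, sq'.fac_left, ← comp_lift, lift_fst_snd, Category.comp_id]

theorem isTrivFib_snd (hA : IsTrivFib (toPt A)) : IsTrivFib (snd A B) := by
  rintro _ _ _ ⟨n⟩
  refine ⟨fun {b z} sq => ?_⟩
  have := hA.hasLiftingProperty (∂Δ[n] : (Δ[n] : SSet.{u}).Subcomplex).ι
  have sq' : CommSq (b ≫ fst A B) (∂Δ[n] : (Δ[n] : SSet.{u}).Subcomplex).ι (toPt A) (toPt _) :=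
    ⟨SSet.stdSimplex.isTerminalObj₀.hom_ext _ _⟩
  refine ⟨⟨⟨lift sq'.lift z, ?_, lift_snd _ _⟩⟩⟩
  rw [comp_lift, ← sq.w, sq'.fac_left, ← comp_lift, lift_fst_snd, Category.comp_id]

/-- The diagonal action on a product. -/
instance [SimplicialAction G A] [SimplicialAction G B] : SimplicialAction G (A ⊗ B) where
  mulAction k := inferInstanceAs (MulAction (G.obj k) (A.obj k × B.obj k))
  map_smul θ g x := Prod.ext (SimplicialAction.map_smul θ g x.1) (SimplicialAction.map_smul θ g x.2)

theorem isEquivariant_fst [SimplicialAction G A] [SimplicialAction G B] :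
    IsEquivariant G (fst A B) := fun _ _ _ => rfl

theorem isEquivariant_snd [SimplicialAction G A] [SimplicialAction G B] :
    IsEquivariant G (snd A B) := fun _ _ _ => rfl

theorem isLevelwiseFree_EG : IsLevelwiseFree G (EG G) := fun _ _ _ h =>
  mul_eq_right.1 (congrFun h 0)

/-- Both projections of `X ⊗ EG G` induce trivial fibrations of quotients; a section of the first
one lifts to an equivariant map `X ⟶ X ⊗ EG G`. -/
theorem exists_classifyingMap {X : SSet.{u}} [SimplicialAction G X] (hfree : IsLevelwiseFree G X)
    (hX : IsTrivFib (toPt X)) :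
    ∃ (F : X ⟶ EG G) (hF : IsEquivariant G F),
      IsRealizationEquiv (X := orbitSpace G X) (Y := BG G) (orbitMap G F hF) := by
  have hfst : IsEquivariant G (fst X (EG G)) := isEquivariant_fst
  have hsnd : IsEquivariant G (snd X (EG G)) := isEquivariant_snd
  have hp : IsTrivFib (orbitMap G _ hfst) :=
    isTrivFib_orbitMap hfst hfree (isTrivFib_fst isTrivFib_EG)
  have hq : IsTrivFib (orbitMap G _ hsnd) :=
    isTrivFib_orbitMap hsnd isLevelwiseFree_EG (isTrivFib_snd hX)
  obtain ⟨σ, hσ⟩ := hp.exists_section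
  obtain ⟨l, hlσ, hl⟩ := exists_lift_orbitProj hfst hfree (q := orbitProj G X ≫ σ) (a := 𝟙 X)
    (by rw [Category.assoc, hσ, Category.comp_id, Category.id_comp])
  have horb (k) (x : X.obj k) : (orbitProj G (X ⊗ EG G)).app k (l.app k x) =
      σ.app k ((orbitProj G X).app k x) := ConcreteCategory.congr_hom (NatTrans.congr_app hlσ k) x
  have hfstl (k) (x : X.obj k) : (fst X (EG G)).app k (l.app k x) = x :=
    ConcreteCategory.congr_hom (NatTrans.congr_app hl k) x
  have hlequiv : IsEquivariant G l := fun k g x => by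
    refine eq_of_orbitProj_app_eq hfst hfree ?_ ?_
    · rw [horb, orbitProj_app_smul, orbitProj_app_smul, horb]
    · rw [hfstl, hfst k g, hfstl]
  have hF : IsEquivariant G (l ≫ snd X (EG G)) := fun k g x =>
    (congrArg ((snd X (EG G)).app k) (hlequiv k g x)).trans (hsnd k g _)
  have hFσ : orbitMap G _ hF = σ ≫ orbitMap G _ hsnd := by
    rw [← cancel_epi (orbitProj G X), orbitProj_comp_orbitMap, Category.assoc,
      ← orbitProj_comp_orbitMap _ hsnd, ← Category.assoc, hlσ, Category.assoc]
  exact ⟨_, hF, hFσ ▸ isRealizationEquiv_section_comp hp hq hσ⟩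

end Quotients

/-! ### The collared manifold -/

section CollarGeometry

variable {n : ℕ} {W : Type u} [TopologicalSpace W]

theorem isClosed_manifoldBoundary (d : ℕ) : IsClosed (manifoldBoundary d W) := by
  have hcompl : (manifoldBoundary d W)ᶜ =
      ⋃ e : OpenPartialHomeomorph W (EuclideanSpace ℝ (Fin d)), e.source := by
    ext x
    simp [manifoldBoundary]
  rw [← isOpen_compl_iff, hcompl]
  exact isOpen_iUnion fun e => e.open_source

variable (h : BdrySphere n ≃ₜ manifoldBoundary (2 * n) W)

theorem exists_eq_of_mem_boundary {w : W} (hw : w ∈ manifoldBoundary (2 * n) W) :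
    ∃ s, (h s : W) = w :=
  ⟨h.symm ⟨w, hw⟩, by rw [h.apply_symm_apply]⟩

theorem Collared.inr_zero (s : BdrySphere n) :
    Collared.inr h (s, ⟨0, Set.mem_Iic.2 le_rfl⟩) = Collared.inl h (h s) :=
  (Quot.sound ⟨s, rfl, rfl⟩).symm

/-- The retraction of the collared manifold onto `W` which collapses the collar. -/
def Collared.retract : Collared h → W :=
  Quot.lift (Sum.elim id (fun p => (h p.1 : W))) (by rintro _ _ ⟨s, rfl, rfl⟩; rfl)

theorem Collared.retract_inl (w : W) : Collared.retract h (Collared.inl h w) = w := rfl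

theorem Collared.inl_injective : Function.Injective (Collared.inl h) :=
  Function.LeftInverse.injective (Collared.retract_inl h)

theorem Collared.continuous_inl : Continuous (Collared.inl h) :=
  continuous_quot_mk.comp _root_.continuous_inl

theorem Collared.continuous_inr : Continuous (Collared.inr h) :=
  continuous_quot_mk.comp _root_.continuous_inr

theorem Collared.continuous_retract : Continuous (Collared.retract h) := by
  refine continuous_quot_lift _ (continuous_sum_dom.2 ⟨continuous_id, ?_⟩)
  change Continuous fun p : BdrySphere n × Set.Iic (0 : ℝ) => (h p.1 : W)
  fun_prop

theorem continuous_height : Continuous (height h) := by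
  refine continuous_quot_lift _ (continuous_sum_dom.2 ⟨continuous_const, ?_⟩)
  change Continuous fun p : BdrySphere n × Set.Iic (0 : ℝ) => (p.2 : ℝ)
  fun_prop

theorem height_nonpos (x : Collared h) : height h x ≤ 0 :=
  Collared.cases h (P := fun x => height h x ≤ 0) (fun _ => le_rfl) (fun p => p.2.2) x

theorem retract_mem_of_height_neg {x : Collared h} (hx : height h x < 0) :
    Collared.retract h x ∈ manifoldBoundary (2 * n) W := by
  revert hx
  exact Collared.cases h (P := fun x => height h x < 0 → Collared.retract h x ∈ _)
    (fun _ hx => absurd hx (lt_irrefl _)) (fun p _ => (h p.1).2) x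

theorem Collared.inl_eq_inr {w : W} {p : BdrySphere n × Set.Iic (0 : ℝ)} (hw : w = h p.1)
    (hp : (p.2 : ℝ) = 0) : Collared.inl h w = Collared.inr h p := by
  obtain ⟨s, u⟩ := p
  rw [hw, ← Collared.inr_zero]
  exact congrArg (fun v => Collared.inr h (s, v)) (Subtype.ext hp.symm)

theorem Collared.eq_of_retract_of_height {x y : Collared h}
    (hretract : Collared.retract h x = Collared.retract h y)
    (hheight : height h x = height h y) : x = y := by
  obtain ⟨x | p, rfl⟩ := Quot.exists_rep x <;> obtain ⟨y | q, rfl⟩ := Quot.exists_rep y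
  · exact congrArg (Collared.inl h) hretract
  · exact Collared.inl_eq_inr h hretract hheight.symm
  · exact (Collared.inl_eq_inr h hretract.symm hheight).symm
  · exact congrArg (Collared.inr h)
      (Prod.ext (h.injective (Subtype.ext hretract)) (Subtype.ext hheight))

theorem inl_mem_collar_iff {ε : ℝ} (hε : 0 < ε) (w : W) :
    Collared.inl h w ∈ collar h ε ↔ w ∈ manifoldBoundary (2 * n) W := by
  constructor
  · rintro ⟨p, -, hp⟩
    have hw : w = h p.1 := congrArg (Collared.retract h) hp
    rw [hw]
    exact (h p.1).2
  · intro hw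
    obtain ⟨s, rfl⟩ := exists_eq_of_mem_boundary h hw
    exact ⟨(s, ⟨0, Set.mem_Iic.2 le_rfl⟩), by simpa using hε, (Collared.inr_zero h s).symm⟩

theorem neg_lt_height {ε : ℝ} (hε : 0 < ε) {x : Collared h} (hx : x ∈ collared h ε) :
    -ε < height h x := by
  rcases hx with ⟨w, rfl⟩ | ⟨p, hp, rfl⟩
  · exact neg_lt_zero.2 hε
  · exact hp

theorem isCompact_retract_preimage_inter_height_preimage {K : Set W} (hK : IsCompact K)
    (hK' : IsClosed K) (R : ℝ) :
    IsCompact (Collared.retract h ⁻¹' K ∩ height h ⁻¹' Set.Ici (-R)) := by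
  have hsphere : IsCompact ((fun s : BdrySphere n => (h s : W)) ⁻¹' K) :=
    (hK'.preimage (continuous_subtype_val.comp h.continuous)).isCompact
  have hinterval : IsCompact ((fun u : Set.Iic (0 : ℝ) => (u : ℝ)) ⁻¹' Set.Icc (-R) 0) :=
    (isClosed_Iic.isClosedEmbedding_subtypeVal).isCompact_preimage isCompact_Icc
  have hunion := (hK.image (Collared.continuous_inl h)).union
    ((hsphere.prod hinterval).image (Collared.continuous_inr h))
  refine hunion.of_isClosed_subset ((hK'.preimage (Collared.continuous_retract h)).inter
    (isClosed_Ici.preimage (continuous_height h))) ?_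
  intro x hx
  obtain ⟨w | p, rfl⟩ := Quot.exists_rep x
  · exact Or.inl ⟨w, hx.1, rfl⟩
  · exact Or.inr ⟨p, ⟨hx.1, hx.2, p.2.2⟩, rfl⟩

/-- Extension over the collar of a family of maps on `W`. -/
def collarDesc {T E : Type*} (f : T × W → E) (g : BdrySphere n × Set.Iic (0 : ℝ) → E)
    (hfg : ∀ t s, f (t, (h s : W)) = g (s, ⟨0, Set.mem_Iic.2 le_rfl⟩)) (p : T × Collared h) : E :=
  Quot.lift (Sum.elim (fun w => f (p.1, w)) g) (by
    rintro _ _ ⟨s, rfl, rfl⟩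
    exact hfg p.1 s) p.2

theorem continuous_collarDesc {T E : Type*} [TopologicalSpace T] [LocallyCompactSpace T]
    [TopologicalSpace E] {f : T × W → E}
    {g : BdrySphere n × Set.Iic (0 : ℝ) → E} (hf : Continuous f) (hg : Continuous g)
    (hfg : ∀ t s, f (t, (h s : W)) = g (s, ⟨0, Set.mem_Iic.2 le_rfl⟩)) :
    Continuous (collarDesc h f g hfg) := by
  have hq : IsQuotientMap (Quot.mk (CollarRel h)) := isQuotientMap_quot_mk
  refine hq.continuous_lift_prod_right (Y := T) (X := Collared h) ?_
  have hsum : Continuous ((fun p : T × (W ⊕ (BdrySphere n × Set.Iic (0 : ℝ))) =>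
      collarDesc h f g hfg (p.1, Quot.mk _ p.2)) ∘ Homeomorph.prodSumDistrib.symm) :=
    continuous_sum_dom.2 ⟨hf, hg.comp continuous_snd⟩
  exact (Homeomorph.comp_continuous_iff' _).1 hsum

end CollarGeometry

/-! ### Charts -/

section Charts

/-- The interior of the half-space as an open partial homeomorphism. -/
def halfSpaceInterior (d : ℕ) [NeZero d] :
    OpenPartialHomeomorph (EuclideanHalfSpace d) (EuclideanSpace ℝ (Fin d)) :=
  have hright {x : EuclideanSpace ℝ (Fin d)} (hx : 0 < x 0) : modelWithCornersEuclideanHalfSpace d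
      ((modelWithCornersEuclideanHalfSpace d).symm x) = x :=
    (modelWithCornersEuclideanHalfSpace d).right_inv (by
      rw [range_modelWithCornersEuclideanHalfSpace]
      exact hx.le)
  { toFun := modelWithCornersEuclideanHalfSpace d
    invFun := (modelWithCornersEuclideanHalfSpace d).symm
    source := {x | 0 < x.1 0}
    target := {x | 0 < x 0}
    map_source' x hx := hx
    map_target' x hx := by
      change 0 < (modelWithCornersEuclideanHalfSpace d
        ((modelWithCornersEuclideanHalfSpace d).symm x)) 0
      rw [hright hx]
      exact hx
    left_inv' x _ := (modelWithCornersEuclideanHalfSpace d).left_inv x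
    right_inv' x hx := hright hx
    open_source := isOpen_lt continuous_const ((EuclideanSpace.proj (𝕜 := ℝ)
      (0 : Fin d)).continuous.comp continuous_subtype_val)
    open_target := isOpen_lt continuous_const (by fun_prop)
    continuousOn_toFun := (modelWithCornersEuclideanHalfSpace d).continuous.continuousOn
    continuousOn_invFun := (modelWithCornersEuclideanHalfSpace d).continuous_symm.continuousOn }

variable {d : ℕ} [NeZero d] {W : Type u} [TopologicalSpace W]
  [ChartedSpace (EuclideanHalfSpace d) W]

/-- The coordinates of the chart at `w`. -/
def chartCoord (w x : W) : Fin d → ℝ := fun i => (chartAt (EuclideanHalfSpace d) w x).1 i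

theorem continuousOn_chartCoord (w : W) :
    ContinuousOn (chartCoord (d := d) w) (chartAt (EuclideanHalfSpace d) w).source := by
  have hcoord : Continuous (fun y : EuclideanHalfSpace d => fun i => y.1 i) :=
    continuous_pi fun i =>
      (EuclideanSpace.proj (𝕜 := ℝ) i).continuous.comp continuous_subtype_val
  exact hcoord.comp_continuousOn (chartAt (EuclideanHalfSpace d) w).continuousOn

theorem injOn_chartCoord (w : W) :
    Set.InjOn (chartCoord (d := d) w) (chartAt (EuclideanHalfSpace d) w).source := by
  intro x hx y hy hxy
  refine (chartAt (EuclideanHalfSpace d) w).injOn hx hy (Subtype.ext ?_)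
  ext i
  exact congrFun hxy i

theorem chartCoord_zero_nonneg (w x : W) : 0 ≤ chartCoord (d := d) w x 0 :=
  (chartAt (EuclideanHalfSpace d) w x).2

theorem chartCoord_zero_of_mem_boundary {w x : W}
    (hx : x ∈ (chartAt (EuclideanHalfSpace d) w).source) (hb : x ∈ manifoldBoundary d W) :
    chartCoord (d := d) w x 0 = 0 := by
  by_contra hne
  have hpos := lt_of_le_of_ne (chartCoord_zero_nonneg (d := d) w x) (Ne.symm hne)
  refine hb ((chartAt (EuclideanHalfSpace d) w).trans (halfSpaceInterior d)) ?_
  rw [OpenPartialHomeomorph.trans_source]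
  exact ⟨hx, hpos⟩

end Charts

section CollaredCharts

variable {n : ℕ} [NeZero n] {W : Type u} [TopologicalSpace W]
  [ChartedSpace (EuclideanHalfSpace (2 * n)) W]
  (h : BdrySphere n ≃ₜ manifoldBoundary (2 * n) W)

/-- The chart at `w`, extended over the collar by the part of `ℝ²ⁿ` outside of the half-space. -/
def collaredCoord (w : W) (x : Collared h) : Fin (2 * n) → ℝ :=
  chartCoord w (Collared.retract h x) + height h x • Pi.single 0 1

theorem collaredCoord_zero (w : W) (x : Collared h) : collaredCoord h w x 0 =
    chartCoord (d := 2 * n) w (Collared.retract h x) 0 + height h x := by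
  simp [collaredCoord]

theorem continuousOn_collaredCoord (w : W) : ContinuousOn (collaredCoord h w)
    (Collared.retract h ⁻¹' (chartAt (EuclideanHalfSpace (2 * n)) w).source) :=
  ((continuousOn_chartCoord w).comp (Collared.continuous_retract h).continuousOn
    fun _ hx => hx).add ((continuous_height h).smul continuous_const).continuousOn

/-- The collar coordinate is the negative part of the coordinate which is nonnegative on the
half-space. -/
theorem height_eq_min_collaredCoord {w : W} {x : Collared h}
    (hx : Collared.retract h x ∈ (chartAt (EuclideanHalfSpace (2 * n)) w).source) :
    height h x = min (collaredCoord h w x 0) 0 := by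
  rw [collaredCoord_zero]
  rcases (height_nonpos h x).lt_or_eq with hneg | hzero
  · rw [chartCoord_zero_of_mem_boundary hx (retract_mem_of_height_neg h hneg), zero_add,
      min_eq_left hneg.le]
  · rw [hzero, add_zero, min_eq_right (chartCoord_zero_nonneg _ _)]

theorem injOn_collaredCoord (w : W) : Set.InjOn (collaredCoord h w)
    (Collared.retract h ⁻¹' (chartAt (EuclideanHalfSpace (2 * n)) w).source) := by
  intro x hx y hy hxy
  have hheight : height h x = height h y := by
    rw [height_eq_min_collaredCoord h hx, hxy, height_eq_min_collaredCoord h hy]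
  refine Collared.eq_of_retract_of_height h (injOn_chartCoord (d := 2 * n) w hx hy ?_) hheight
  rw [collaredCoord, collaredCoord, hheight] at hxy
  exact add_right_cancel hxy

theorem exists_compact_nhd_injOn_collaredCoord [T2Space W] [CompactSpace W] (x : Collared h) :
    ∃ V K : Set (Collared h), IsOpen V ∧ x ∈ V ∧ V ⊆ K ∧ IsCompact K ∧
      ContinuousOn (collaredCoord h (Collared.retract h x)) K ∧
      Set.InjOn (collaredCoord h (Collared.retract h x)) K := by
  set w := Collared.retract h x
  obtain ⟨K, hK, hwK, hKU⟩ := exists_compact_subset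
    (chartAt (EuclideanHalfSpace (2 * n)) w).open_source (mem_chart_source _ w)
  let R : ℝ := 1 - height h x
  have hsub : Collared.retract h ⁻¹' K ∩ height h ⁻¹' Set.Ici (-R) ⊆
      Collared.retract h ⁻¹' (chartAt (EuclideanHalfSpace (2 * n)) w).source :=
    fun y hy => hKU hy.1
  refine ⟨Collared.retract h ⁻¹' interior K ∩ height h ⁻¹' Set.Ioi (-R),
    Collared.retract h ⁻¹' K ∩ height h ⁻¹' Set.Ici (-R),
    (isOpen_interior.preimage (Collared.continuous_retract h)).inter
      (isOpen_Ioi.preimage (continuous_height h)), ⟨hwK, ?_⟩,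
    Set.inter_subset_inter (Set.preimage_mono interior_subset)
      (Set.preimage_mono Set.Ioi_subset_Ici_self),
    isCompact_retract_preimage_inter_height_preimage h hK hK.isClosed R,
    (continuousOn_collaredCoord h w).mono hsub, (injOn_collaredCoord h w).mono hsub⟩
  change -(1 - height h x) < height h x
  linarith

end CollaredCharts

/-! ### Stable local flatness -/

section StableFlat

variable {B M E P X : Type*} [TopologicalSpace B] [TopologicalSpace M] [TopologicalSpace E]
  [TopologicalSpace P] [TopologicalSpace X]

theorem isEmbedding_shear [AddGroup E] [IsTopologicalAddGroup E] [AddGroup P]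
    [IsTopologicalAddGroup P] {π : X → B} {j : X → P} (hπj : IsEmbedding fun x => (π x, j x))
    {e : X → E} (he : Continuous e) {J : B × E → P} (hJ : Continuous J) :
    IsEmbedding fun q : X × E =>
      (π q.1, (q.2 + e q.1, j q.1 - J (π q.1, q.2 + e q.1))) := by
  have htranslate : IsEmbedding fun q : X × E => (q.1, q.2 + e q.1) :=
    isEmbedding_of_leftInverse (r := fun q => (q.1, q.2 - e q.1)) (by fun_prop) (by fun_prop)
      fun q => Prod.ext rfl (add_sub_cancel_right _ _)
  have hshear : IsEmbedding fun q : (B × P) × E => (q.1.1, (q.2, q.1.2 - J (q.1.1, q.2))) :=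
    isEmbedding_of_leftInverse (r := fun q => ((q.1, q.2.2 + J (q.1, q.2.1)), q.2.1))
      (by fun_prop) (by fun_prop) fun q => Prod.ext (Prod.ext rfl (sub_add_cancel _ _)) rfl
  exact hshear.comp ((hπj.prodMap IsEmbedding.id).comp htranslate)

theorem isClosedEmbedding_prodMk_of_isCompact [CompactSpace B] [T2Space B] [T2Space E]
    {e : B × M → E} (he : Continuous e) (hinj : ∀ b, Function.Injective fun x => e (b, x))
    {K : Set M} (hK : IsCompact K) :
    IsClosedEmbedding fun p : B × K => (p.1, e (p.1, p.2)) := by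
  have : CompactSpace K := isCompact_iff_compactSpace.1 hK
  refine Continuous.isClosedEmbedding (by fun_prop) ?_
  rintro ⟨b, x⟩ ⟨b', x'⟩ hbx
  obtain ⟨rfl, hxx'⟩ := Prod.mk.inj hbx
  exact Prod.ext rfl (Subtype.ext (hinj b hxx'))

theorem isEmbedding_stab {a b : ℕ} (hab : a ≤ b) :
    IsEmbedding (stab : (Fin a → ℝ) × ℝ → (Fin b → ℝ) × ℝ) :=
  isEmbedding_of_leftInverse (r := stab) continuous_stab continuous_stab fun x =>
    Prod.ext ((pad_pad hab x.1).trans (pad_self x.1)) rfl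

/-- Appending `m` coordinates to the first factor of `ℝᵐ⁺ᶜ × ℝ`, so as to extend `stab`. -/
def appendCoord {m c : ℕ} (p : ((Fin (m + c) → ℝ) × ℝ) × (Fin m → ℝ)) :
    (Fin (m + (c + m)) → ℝ) × ℝ :=
  (fun i => if hi : (i : ℕ) < m + c then p.1.1 ⟨i, hi⟩ else p.2 ⟨i - (m + c), by omega⟩, p.1.2)

theorem appendCoord_zero {m c : ℕ} (x : (Fin (m + c) → ℝ) × ℝ) :
    appendCoord (x, 0) = stab x := rfl

theorem isEmbedding_appendCoord {m c : ℕ} : IsEmbedding (appendCoord (m := m) (c := c)) := by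
  refine isEmbedding_of_leftInverse (r := fun z =>
    ((fun i => z.1 (Fin.castLE (by omega) i), z.2), fun i => z.1 ⟨m + c + i, by omega⟩))
    (Continuous.prodMk (continuous_pi fun i => ?_) (by fun_prop)) (by fun_prop) fun p =>
      Prod.ext (Prod.ext (funext fun i => ?_) rfl) (funext fun i => ?_)
  · split_ifs <;> fun_prop
  all_goals simp [appendCoord]

/-- By Tietze, the coordinate `j` extends over the ambient space to a function `J`. The tube
consists of the points `(y, j x - J y)`, from which `j x`, and hence `x`, can be recovered. -/
theorem exists_tube_stab [CompactSpace B] [TopologicalSpace.MetrizableSpace B] {m c : ℕ}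
    {e : B × M → (Fin (m + c) → ℝ) × ℝ} (he : Continuous e)
    (hinj : ∀ b, Function.Injective fun x => e (b, x)) {K : Set M} (hK : IsCompact K)
    {j : M → Fin m → ℝ} (hjK : ContinuousOn j K) (hjinj : Set.InjOn j K) {ι : X → K}
    (hι : IsEmbedding ι) :
    ∃ F : (B × X) × (Fin (c + m + 1) → ℝ) → (Fin (m + (c + m)) → ℝ) × ℝ,
      IsEmbedding (fun q : (B × X) × (Fin (c + m + 1) → ℝ) => (q.1.1, F q)) ∧
      ∀ b x, F ((b, x), 0) = stab (e (b, ι x)) := by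
  have : CompactSpace K := isCompact_iff_compactSpace.1 hK
  have hj : IsEmbedding fun v : K => j v :=
    (Continuous.isClosedEmbedding (continuousOn_iff_continuous_domRestrict.1 hjK)
      (Set.injOn_iff_injective.1 hjinj)).isEmbedding
  obtain ⟨J, hJ⟩ := ContinuousMap.exists_extension'
    (isClosedEmbedding_prodMk_of_isCompact he hinj hK)
    ⟨fun p : B × K => j p.2, hj.continuous.comp continuous_snd⟩
  have hJe : ∀ b (v : K), J (b, e (b, v)) = j v := fun b v => congrFun hJ (b, v)
  let L : (Fin (c + m + 1) → ℝ) ≃L[ℝ] (Fin (m + c) → ℝ) × ℝ :=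
    ContinuousLinearEquiv.ofFinrankEq (by simp [Nat.add_comm])
  have hιc : Continuous ι := hι.continuous
  let e' : B × X → (Fin (m + c) → ℝ) × ℝ := fun p => e (p.1, ι p.2)
  have hshear := isEmbedding_shear (IsEmbedding.id.prodMap (hj.comp hι))
    (e := e') (by fun_prop) J.continuous
  refine ⟨fun q => appendCoord (L q.2 + e' q.1, j (ι q.1.2) - J (q.1.1, L q.2 + e' q.1)),
    (IsEmbedding.id.prodMap isEmbedding_appendCoord).comp
      (hshear.comp (IsEmbedding.id.prodMap L.toHomeomorph.isEmbedding)), fun b x => ?_⟩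
  simp only [map_zero, zero_add, e', hJe, sub_self, appendCoord_zero]

theorem isLocallyFlatEmbeddingOver_stab [CompactSpace B] [TopologicalSpace.MetrizableSpace B]
    {m c : ℕ} {S : Set M} {e : B × M → (Fin (m + c) → ℝ) × ℝ} (he : Continuous e)
    (hinj : ∀ b, Function.Injective fun x => e (b, x))
    (hchart : ∀ x : M, ∃ (V K : Set M) (j : M → Fin m → ℝ),
      IsOpen V ∧ x ∈ V ∧ V ⊆ K ∧ IsCompact K ∧ ContinuousOn j K ∧ Set.InjOn j K)
    (hS : ∃ K, IsCompact K ∧ S ⊆ K) :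
    IsLocallyFlatEmbeddingOver (c + m + 1)
      (fun p : B × S => (stab (e (p.1, p.2)) : (Fin (m + (c + m)) → ℝ) × ℝ)) := by
  refine ⟨?_, fun b x => ?_⟩
  · obtain ⟨K, hK, hSK⟩ := hS
    exact (IsEmbedding.id.prodMap (isEmbedding_stab (by omega))).comp
      ((isClosedEmbedding_prodMk_of_isCompact he hinj hK).isEmbedding.comp
        (IsEmbedding.id.prodMap (IsEmbedding.inclusion hSK)))
  · obtain ⟨V, K, j, hV, hxV, hVK, hK, hjK, hjinj⟩ := hchart x
    have hι : IsEmbedding fun v : ((↑) : S → M) ⁻¹' V => (⟨v.1.1, hVK v.2⟩ : K) :=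
      (IsEmbedding.subtypeVal.comp IsEmbedding.subtypeVal).codRestrict K fun v => hVK v.2
    obtain ⟨F, hF, hFzero⟩ := exists_tube_stab he hinj hK hjK hjinj hι
    refine ⟨Set.univ, ((↑) : S → M) ⁻¹' V, isOpen_univ, trivial,
      hV.preimage continuous_subtype_val, hxV,
      fun q => F ((q.1.1, q.1.2), q.2),
      hF.comp ((IsEmbedding.subtypeVal.prodMap IsEmbedding.id).prodMap IsEmbedding.id),
      fun y v => hFzero y v⟩

end StableFlat

/-! ### Simplices of the colimit as families of maps to `ℝ^∞` -/

section StabInf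

/-- The inclusion `ℝᵃ × ℝ → ℝ^ℕ × ℝ` which is standard on the first factor and preserves the last
coordinate. -/
def stabInf {a : ℕ} (x : (Fin a → ℝ) × ℝ) : (ℕ → ℝ) × ℝ :=
  (fun i => if hi : i < a then x.1 ⟨i, hi⟩ else 0, x.2)

theorem stabInf_fst_apply {a : ℕ} (x : (Fin a → ℝ) × ℝ) (i : Fin a) : (stabInf x).1 i = x.1 i :=
  dif_pos i.2

theorem stabInf_fst_of_le {a i : ℕ} (x : (Fin a → ℝ) × ℝ) (hi : a ≤ i) : (stabInf x).1 i = 0 :=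
  dif_neg hi.not_gt

theorem stabInf_injective {a : ℕ} : Function.Injective (stabInf (a := a)) := by
  intro x y hxy
  refine Prod.ext (funext fun i => ?_) (Prod.ext_iff.1 hxy).2
  rw [← stabInf_fst_apply, hxy, stabInf_fst_apply]

theorem continuous_stabInf {a : ℕ} : Continuous (stabInf (a := a)) := by
  refine Continuous.prodMk (continuous_pi fun i => ?_) (by fun_prop)
  split_ifs <;> fun_prop

theorem stabInf_stab {a b : ℕ} (hab : a ≤ b) (x : (Fin a → ℝ) × ℝ) :
    stabInf (stab x : (Fin b → ℝ) × ℝ) = stabInf x := by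
  refine Prod.ext (funext fun i => ?_) rfl
  simp only [stabInf, stab, pad]
  split_ifs <;> first | rfl | omega

theorem stabInf_truncate {a : ℕ} {y : (ℕ → ℝ) × ℝ} (hy : ∀ i, a ≤ i → y.1 i = 0) :
    stabInf (fun i : Fin a => y.1 i, y.2) = y := by
  refine Prod.ext (funext fun i => ?_) rfl
  rcases lt_or_ge i a with hi | hi
  · exact dif_pos hi
  · rw [stabInf_fst_of_le _ hi, hy i hi]

variable {n : ℕ}

/-- The standard inclusion `S²ⁿ⁻¹ → ℝ²ⁿ × {0} → ℝ^ℕ × ℝ`. -/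
def stdSphere (s : BdrySphere n) : (ℕ → ℝ) × ℝ := stabInf (fun i => s.1 i, 0)

theorem continuous_coordinates_sphere :
    Continuous fun s : BdrySphere n => fun i : Fin (2 * n) => s.1 i :=
  (PiLp.continuous_ofLp 2 _).comp continuous_subtype_val

theorem continuous_stdSphere : Continuous (stdSphere (n := n)) :=
  continuous_stabInf.comp (continuous_coordinates_sphere.prodMk continuous_const)

theorem stdSphere_injective : Function.Injective (stdSphere (n := n)) := by
  intro s s' hs
  ext i
  exact congrFun (Prod.ext_iff.1 (stabInf_injective hs)).1 i

theorem std_eq_stab (c : ℕ) (p : BdrySphere n × Set.Iic (0 : ℝ)) :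
    std c p = stab (fun i => p.1.1 i, (p.2 : ℝ)) := rfl

theorem stab_std {c c' : ℕ} (p : BdrySphere n × Set.Iic (0 : ℝ)) :
    (stab (std c p) : (Fin (2 * n + c') → ℝ) × ℝ) = std c' p :=
  Prod.ext (pad_pad (by omega) _) rfl

theorem stabInf_std_zero (c : ℕ) (s : BdrySphere n) :
    stabInf (std c (s, ⟨0, Set.mem_Iic.2 le_rfl⟩)) = stdSphere s :=
  stabInf_stab (Nat.le_add_right (2 * n) c) (fun i => s.1 i, 0)

theorem continuous_std (c : ℕ) : Continuous (std (n := n) c) :=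
  continuous_stab.comp ((continuous_coordinates_sphere.comp continuous_fst).prodMk (by fun_prop))

theorem std_injective (c : ℕ) : Function.Injective (std (n := n) c) := by
  rintro ⟨s, u⟩ ⟨s', u'⟩ hp
  rw [std_eq_stab, std_eq_stab] at hp
  obtain ⟨hs, hu⟩ := Prod.ext_iff.1 ((isEmbedding_stab (by omega)).injective hp)
  refine Prod.ext (Subtype.ext ?_) (Subtype.ext hu)
  ext i
  exact congrFun hs i

end StabInf

section Stable

variable {n : ℕ} {W : Type u} [TopologicalSpace W]
  (h : BdrySphere n ≃ₜ manifoldBoundary (2 * n) W)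

/-- A family over `D` of injections of `W` into a finite-dimensional subspace of `ℝ^ℕ × [0, ∞)`,
standard on the boundary and with positive last coordinate elsewhere. These are the families of
maps underlying the simplices of `EmbInf`, with local flatness and the collar left out. -/
structure IsStableFamily {T : Type*} [TopologicalSpace T] (D : Set T)
    (f : T × W → (ℕ → ℝ) × ℝ) : Prop where
  continuousOn : ContinuousOn f (D ×ˢ Set.univ)
  bounded : ∃ M : ℕ, ∀ t ∈ D, ∀ w, ∀ i, M ≤ i → (f (t, w)).1 i = 0
  injective : ∀ t ∈ D, Function.Injective fun w => f (t, w)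
  boundary : ∀ t ∈ D, ∀ s, f (t, (h s : W)) = stdSphere s
  pos : ∀ t ∈ D, ∀ w, w ∉ manifoldBoundary (2 * n) W → 0 < (f (t, w)).2

variable {h}

/-- The inclusion `W → W_ε`. -/
def Collared.inlOn (ε : ℝ) (w : W) : collared h ε := ⟨Collared.inl h w, Or.inl ⟨w, rfl⟩⟩

theorem Collared.continuous_inlOn (ε : ℝ) : Continuous (Collared.inlOn (h := h) ε) :=
  (Collared.continuous_inl h).subtype_mk _

theorem Collared.inlOn_injective (ε : ℝ) : Function.Injective (Collared.inlOn (h := h) ε) :=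
  fun _ _ hw => Collared.inl_injective h (congrArg Subtype.val hw)

section EmbSimplex

variable {c : ℕ} {ε : ℝ} {k : SimplexCategory}

/-- The family of maps `W → ℝ^ℕ × ℝ` underlying a simplex of the space of embeddings. -/
def EmbSimplex.stable (e : EmbSimplex h c ε k) (p : Simp k × W) : (ℕ → ℝ) × ℝ :=
  stabInf (e.toFun (p.1, Collared.inlOn ε p.2))

theorem EmbSimplex.stable_injective :
    Function.Injective (EmbSimplex.stable : EmbSimplex h c ε k → _) := by
  intro e e' hee
  refine EmbSimplex.ext (funext fun p => ?_)
  obtain ⟨t, x, ⟨w, rfl⟩ | ⟨q, hq, rfl⟩⟩ := p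
  · exact stabInf_injective (congrFun hee (t, w))
  · rw [e.eq_std t q hq, e'.eq_std t q hq]

theorem EmbSimplex.stable_transition {c' : ℕ} {ε' : ℝ} (hc : c ≤ c') (hε' : 0 < ε')
    (hε : ε' ≤ ε) (e : EmbSimplex h c ε k) : (e.transition hc hε' hε).stable = e.stable :=
  funext fun _ => stabInf_stab (by omega) _

theorem EmbSimplex.isStableFamily (hε : 0 < ε) (e : EmbSimplex h c ε k) :
    IsStableFamily h Set.univ e.stable where
  continuousOn := by
    have hcont : Continuous e.toFun := continuous_snd.comp e.locallyFlat.isEmbedding.continuous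
    exact (continuous_stabInf.comp (hcont.comp (continuous_fst.prodMk
      ((Collared.continuous_inlOn ε).comp continuous_snd)))).continuousOn
  bounded := ⟨2 * n + c, fun _ _ _ _ hi => stabInf_fst_of_le _ hi⟩
  injective t _ w w' hw := by
    have hinl := e.locallyFlat.isEmbedding.injective (a₁ := (t, Collared.inlOn ε w))
      (a₂ := (t, Collared.inlOn ε w')) (Prod.ext rfl (stabInf_injective hw))
    exact Collared.inlOn_injective ε (Prod.ext_iff.1 hinl).2
  boundary t _ s := by
    rw [← stabInf_std_zero c, ← e.eq_std t _ (neg_lt_zero.2 hε)]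
    exact congrArg (fun x => stabInf (e.toFun (t, x))) (Subtype.ext (Collared.inr_zero h s).symm)
  pos t _ w hw := by
    by_contra hneg
    exact hw ((inl_mem_collar_iff h hε w).1 ((e.nonpos_iff t _).1 (not_lt.1 hneg)))

end EmbSimplex

section EmbInfSimplex

variable {j k : SimplexCategory}

/-- The family of maps `W → ℝ^ℕ × ℝ` underlying a simplex of the colimit. -/
def EmbInfSimplex.stable : EmbInfSimplex h k → Simp k × W → (ℕ → ℝ) × ℝ :=
  DirectLimit.lift (embTransition k) (fun _ e => e.stable)
    (fun _ j hij e => (e.stable_transition hij.1 j.2.ofDual.2 hij.2).symm)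

theorem EmbInfSimplex.stable_injective :
    Function.Injective (EmbInfSimplex.stable : EmbInfSimplex h k → _) :=
  DirectLimit.lift_injective _ _ _ fun _ => EmbSimplex.stable_injective

theorem EmbInfSimplex.isStableFamily (x : EmbInfSimplex h k) :
    IsStableFamily h Set.univ x.stable := by
  obtain ⟨i, e, rfl⟩ := DirectLimit.exists_eq_mk _ x
  exact e.isStableFamily i.2.ofDual.2

theorem EmbInfSimplex.stable_pullback (θ : j ⟶ k) (x : EmbInfSimplex h k) (t : Simp j) (w : W) :
    (x.pullback θ).stable (t, w) = x.stable (simpMap θ t, w) := by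
  obtain ⟨i, e, rfl⟩ := DirectLimit.exists_eq_mk _ x
  rfl

theorem EmbInfSimplex.stable_act (φ : topBdry (2 * n) W k) (x : EmbInfSimplex h k) (t : Simp k)
    (w : W) : (x.act φ).stable (t, w) = x.stable (t, ((φ⁻¹).1 (t, w)).2) := by
  obtain ⟨i, e, rfl⟩ := DirectLimit.exists_eq_mk _ x
  rfl

theorem EmbInfSimplex.eq_one_of_act_eq {φ : topBdry (2 * n) W k} {x : EmbInfSimplex h k}
    (hx : x.act φ = x) : φ = 1 := by
  refine inv_eq_one.1 (topBdry.ext_snd fun t w => x.isStableFamily.injective t trivial ?_)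
  have hact := x.stable_act φ t w
  rw [hx] at hact
  exact hact.symm

variable (h) in
theorem isLevelwiseFree_EmbInf : IsLevelwiseFree (TopBdry (2 * n) W) (EmbInf h) :=
  fun _ _ _ hx => EmbInfSimplex.eq_one_of_act_eq hx

end EmbInfSimplex

theorem IsStableFamily.snd_nonpos_iff {T : Type*} [TopologicalSpace T] {D : Set T}
    {f : T × W → (ℕ → ℝ) × ℝ} (hf : IsStableFamily h D f) {t : T} (ht : t ∈ D) (w : W) :
    (f (t, w)).2 ≤ 0 ↔ w ∈ manifoldBoundary (2 * n) W := by
  refine ⟨fun hle => by_contra fun hw => (hf.pos t ht w hw).not_ge hle, fun hw => ?_⟩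
  obtain ⟨s, rfl⟩ := exists_eq_of_mem_boundary h hw
  rw [hf.boundary t ht]
  rfl

end Stable

/-! ### Realizing stable families by simplices -/

section Realize

variable {n c : ℕ} {W : Type u} [TopologicalSpace W]
  {h : BdrySphere n ≃ₜ manifoldBoundary (2 * n) W}

theorem Collared.exists_inl_or_inr (x : Collared h) :
    (∃ w, w ∉ manifoldBoundary (2 * n) W ∧ x = Collared.inl h w) ∨ ∃ p, x = Collared.inr h p := by
  obtain ⟨w | p, rfl⟩ := Quot.exists_rep x
  · by_cases hw : w ∈ manifoldBoundary (2 * n) W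
    · obtain ⟨p, -, hp⟩ := (inl_mem_collar_iff h one_pos w).2 hw
      exact Or.inr ⟨p, hp⟩
    · exact Or.inl ⟨w, hw, rfl⟩
  · exact Or.inr ⟨p, rfl⟩

theorem IsStableFamily.eq_std_of_stabInf {T : Type*} [TopologicalSpace T]
    {f : T × W → (Fin (2 * n + c) → ℝ) × ℝ}
    (hf : IsStableFamily h Set.univ fun p => stabInf (f p)) (t : T) (s : BdrySphere n) :
    f (t, (h s : W)) = std c (s, ⟨0, Set.mem_Iic.2 le_rfl⟩) :=
  stabInf_injective ((hf.boundary t trivial s).trans (stabInf_std_zero c s).symm)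

theorem IsStableFamily.injective_collarDesc {T : Type*} [TopologicalSpace T]
    {f : T × W → (Fin (2 * n + c) → ℝ) × ℝ}
    (hf : IsStableFamily h Set.univ fun p => stabInf (f p)) (t : T) :
    Function.Injective fun x => collarDesc h f (std c) hf.eq_std_of_stabInf (t, x) := by
  intro x y hxy
  rcases Collared.exists_inl_or_inr x with ⟨w, hw, rfl⟩ | ⟨p, rfl⟩ <;>
    rcases Collared.exists_inl_or_inr y with ⟨w', hw', rfl⟩ | ⟨p', rfl⟩
  · exact congrArg _ (hf.injective t trivial (congrArg stabInf hxy))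
  · exact absurd ((congrArg Prod.snd hxy).trans_le p'.2.2) (hf.pos t trivial w hw).not_ge
  · exact absurd ((congrArg Prod.snd hxy).symm.trans_le p.2.2) (hf.pos t trivial w' hw').not_ge
  · exact congrArg _ (std_injective c hxy)

variable [NeZero n] [T2Space W] [CompactSpace W] [ChartedSpace (EuclideanHalfSpace (2 * n)) W]
  {k : SimplexCategory}

theorem IsStableFamily.exists_embSimplex_stable_eq {f : Simp k × W → (Fin (2 * n + c) → ℝ) × ℝ}
    (hcont : Continuous f) (hf : IsStableFamily h Set.univ fun p => stabInf (f p)) :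
    ∃ e : EmbSimplex h (c + 2 * n) 1 k, e.stable = fun p => stabInf (f p) := by
  have : CompactSpace (Simp k) := isCompact_iff_compactSpace.1 (isCompact_stdSimplex ℝ _)
  let e := collarDesc h f (std c) hf.eq_std_of_stabInf
  have hchart (x : Collared h) : ∃ (V K : Set (Collared h)) (j : Collared h → Fin (2 * n) → ℝ),
      IsOpen V ∧ x ∈ V ∧ V ⊆ K ∧ IsCompact K ∧ ContinuousOn j K ∧ Set.InjOn j K :=
    let ⟨V, K, hVK⟩ := exists_compact_nhd_injOn_collaredCoord h x
    ⟨V, K, _, hVK⟩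
  have hcompact : ∃ K, IsCompact K ∧ collared h 1 ⊆ K :=
    ⟨_, isCompact_retract_preimage_inter_height_preimage h isCompact_univ isClosed_univ 1,
      fun x hx => ⟨trivial, (neg_lt_height h one_pos hx).le⟩⟩
  refine ⟨{
    toFun := fun p => stab (e (p.1, p.2))
    locallyFlat := isLocallyFlatEmbeddingOver_stab
      (continuous_collarDesc h hcont (continuous_std c) _) hf.injective_collarDesc hchart hcompact
    eq_std := fun _ p _ => stab_std p
    nonpos_iff := ?_ }, funext fun p => stabInf_stab (by omega) _⟩
  rintro t ⟨x, ⟨w, rfl⟩ | ⟨p, hp, rfl⟩⟩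
  · exact (hf.snd_nonpos_iff trivial w).trans (inl_mem_collar_iff h one_pos w).symm
  · exact ⟨fun _ => ⟨p, hp, rfl⟩, fun _ => p.2.2⟩

theorem IsStableFamily.exists_stable_eq {f : Simp k × W → (ℕ → ℝ) × ℝ}
    (hf : IsStableFamily h Set.univ f) : ∃ x : EmbInfSimplex h k, x.stable = f := by
  obtain ⟨M, hM⟩ := hf.bounded
  let f₀ : Simp k × W → (Fin (2 * n + M) → ℝ) × ℝ := fun p => (fun i => (f p).1 i, (f p).2)
  have hf₀ : f = fun p => stabInf (f₀ p) :=
    funext fun p => (stabInf_truncate fun i hi => hM p.1 trivial p.2 i (by omega)).symm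
  have hcont : Continuous f := by
    have hcontOn := hf.continuousOn
    rwa [Set.univ_prod_univ, continuousOn_univ] at hcontOn
  obtain ⟨e, he⟩ := IsStableFamily.exists_embSimplex_stable_eq (f := f₀) (by fun_prop) (hf₀ ▸ hf)
  exact ⟨⟦⟨(M + 2 * n, OrderDual.toDual ⟨1, one_pos⟩), e⟩⟧, he.trans hf₀.symm⟩

end Realize

/-! ### Euclidean embeddings of the interior -/

section Interior

variable (d : ℕ) [NeZero d] {W : Type u} [TopologicalSpace W] [T2Space W] [CompactSpace W]

theorem exists_bump_injOn_support [ChartedSpace (EuclideanHalfSpace d) W] (w : W) :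
    ∃ (ρ : C(W, ℝ)) (g : C(W, Fin d → ℝ)) (U : Set W),
      IsOpen U ∧ w ∈ U ∧ Set.EqOn ρ 1 U ∧ Set.InjOn g (Function.support ρ) := by
  obtain ⟨K, hK, hwK, hKU⟩ := exists_compact_subset
    (chartAt (EuclideanHalfSpace d) w).open_source (mem_chart_source _ w)
  obtain ⟨L, hL, hwL, hLK⟩ := exists_compact_subset isOpen_interior hwK
  obtain ⟨g, hg⟩ := ContinuousMap.exists_restrict_eq hK.isClosed
    ⟨_, continuousOn_iff_continuous_domRestrict.1 ((continuousOn_chartCoord (d := d) w).mono hKU)⟩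
  have hgK : Set.EqOn g (chartCoord (d := d) w) K := fun x hx => DFunLike.congr_fun hg ⟨x, hx⟩
  obtain ⟨ρ, hρ_zero, hρ_one, -⟩ := exists_continuous_zero_one_of_isClosed
    (isOpen_interior (s := K)).isClosed_compl hL.isClosed
    (Set.disjoint_compl_left_iff_subset.2 hLK)
  have hsupp : Function.support ρ ⊆ K := fun x hx =>
    interior_subset (not_not.1 fun hxK => hx (hρ_zero hxK))
  exact ⟨ρ, g, interior L, isOpen_interior, hwL, hρ_one.mono interior_subset,
    (hgK.injOn_iff.2 ((injOn_chartCoord (d := d) w).mono hKU)).mono hsupp⟩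

variable (W) in
theorem exists_continuous_injective [ChartedSpace (EuclideanHalfSpace d) W] :
    ∃ (m : ℕ) (ψ : C(W, Fin m → ℝ)), Function.Injective ψ := by
  choose ρ g U hU hwU hρ hg using exists_bump_injOn_support (W := W) d
  obtain ⟨s, hs⟩ := isCompact_univ.elim_finite_subcover U hU fun w _ => Set.mem_iUnion.2 ⟨w, hwU w⟩
  let Ψ : C(W, s → ℝ × (Fin d → ℝ)) :=
    ⟨fun x w => (ρ w x, ρ w x • g w x), by fun_prop⟩
  have hΨ : Function.Injective Ψ := by
    intro x y hxy
    obtain ⟨w, hw⟩ := Set.mem_iUnion.1 (hs (Set.mem_univ x))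
    obtain ⟨hws, hxw⟩ := Set.mem_iUnion.1 hw
    obtain ⟨hρxy, hgxy⟩ := Prod.mk.inj (congrFun hxy ⟨w, hws⟩)
    have hx : ρ w x ≠ 0 := (hρ w hxw).trans_ne one_ne_zero
    rw [← hρxy] at hgxy
    exact hg w hx (hρxy ▸ hx : ρ w y ≠ 0) (smul_right_injective _ hx hgxy)
  let L : (s → ℝ × (Fin d → ℝ)) ≃L[ℝ] (Fin (Module.finrank ℝ (s → ℝ × (Fin d → ℝ))) → ℝ) :=
    ContinuousLinearEquiv.ofFinrankEq (Module.finrank_fin_fun ℝ).symm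
  exact ⟨_, ⟨L ∘ Ψ, by fun_prop⟩, L.injective.comp hΨ⟩

variable {d} in
theorem exists_continuous_injOn_interior [ChartedSpace (EuclideanHalfSpace d) W]
    (hne : (manifoldBoundary d W).Nonempty) :
    ∃ (m : ℕ) (ι : C(W, Fin (m + 1) → ℝ)), (∀ w ∈ manifoldBoundary d W, ι w = 0) ∧
      (∀ w ∉ manifoldBoundary d W, 0 < ι w 0) ∧ Set.InjOn ι (manifoldBoundary d W)ᶜ := by
  obtain ⟨m, ψ, hψ⟩ := exists_continuous_injective d W
  have hclosed := (ψ.continuous.isClosedEmbedding hψ).isClosedMap _ (isClosed_manifoldBoundary d)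
  let δ : W → ℝ := fun w => Metric.infDist (ψ w) (ψ '' manifoldBoundary d W)
  have hδ : Continuous δ := (Metric.continuous_infDist_pt _).comp ψ.continuous
  have hδ_pos : ∀ w ∉ manifoldBoundary d W, 0 < δ w := fun w hw =>
    (hclosed.notMem_iff_infDist_pos (hne.image ψ)).1 (hψ.mem_set_image.not.2 hw)
  refine ⟨m, ⟨fun w => Matrix.vecCons (δ w) (δ w • ψ w), by fun_prop⟩, fun w hw => ?_, hδ_pos,
    fun w hw w' _ hww' => ?_⟩
  · have hδ_zero : δ w = 0 := Metric.infDist_zero_of_mem (Set.mem_image_of_mem ψ hw)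
    change Matrix.vecCons (δ w) (δ w • ψ w) = 0
    rw [hδ_zero, zero_smul]
    exact Matrix.cons_zero_zero
  · obtain ⟨hδδ, hψψ⟩ := Matrix.vecCons_inj.1 hww'
    rw [← hδδ] at hψψ
    exact hψ (smul_right_injective _ (hδ_pos w hw).ne' hψψ)

end Interior

/-! ### Extension of stable families -/

section Extension

/-- Keeps the first `M` coordinates of `y`, puts the coordinates of `v` after them, and raises the
absolute value of the last coordinate by `v 0`. -/
def perturb (M : ℕ) {m : ℕ} (y : (ℕ → ℝ) × ℝ) (v : Fin (m + 1) → ℝ) : (ℕ → ℝ) × ℝ :=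
  stabInf (Fin.append (fun i : Fin M => y.1 i) v, |y.2| + v 0)

variable {M m : ℕ}

theorem perturb_zero {y : (ℕ → ℝ) × ℝ} (hM : ∀ i, M ≤ i → y.1 i = 0) (hy : 0 ≤ y.2) :
    perturb M y (0 : Fin (m + 1) → ℝ) = y := by
  have happend : Fin.append (fun i : Fin M => y.1 i) (0 : Fin (m + 1) → ℝ) =
      fun i : Fin (M + (m + 1)) => y.1 i := by
    refine funext fun i => ?_
    induction i using Fin.addCases with
    | left i => rw [Fin.append_left, Fin.val_castAdd]
    | right i => rw [Fin.append_right, Fin.val_natAdd, hM _ (Nat.le_add_right M i), Pi.zero_apply]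
  rw [perturb, happend, Pi.zero_apply, add_zero, abs_of_nonneg hy]
  exact stabInf_truncate fun i hi => hM i ((Nat.le_add_right M _).trans hi)

theorem eq_of_perturb_eq {y y' : (ℕ → ℝ) × ℝ} {v v' : Fin (m + 1) → ℝ}
    (hv : perturb M y v = perturb M y' v') : v = v' := by
  have happend := (Prod.mk.inj (stabInf_injective hv)).1
  refine funext fun i => ?_
  simpa only [Fin.append_right] using congrFun happend (Fin.natAdd M i)

theorem perturb_snd_pos (y : (ℕ → ℝ) × ℝ) {v : Fin (m + 1) → ℝ} (hv : 0 < v 0) :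
    0 < (perturb M y v).2 :=
  add_pos_of_nonneg_of_pos (abs_nonneg _) hv

theorem continuous_perturb :
    Continuous fun q : ((ℕ → ℝ) × ℝ) × (Fin (m + 1) → ℝ) => perturb M q.1 q.2 := by
  refine continuous_stabInf.comp (Continuous.prodMk (continuous_pi fun i => ?_) (by fun_prop))
  induction i using Fin.addCases with
  | left i => simp only [Fin.append_left]; fun_prop
  | right i => simp only [Fin.append_right]; fun_prop

variable {n : ℕ} {W : Type u} [TopologicalSpace W]
  {h : BdrySphere n ≃ₜ manifoldBoundary (2 * n) W}

theorem nonempty_manifoldBoundary [NeZero n] (h : BdrySphere n ≃ₜ manifoldBoundary (2 * n) W) :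
    (manifoldBoundary (2 * n) W).Nonempty :=
  have ⟨s, hs⟩ := NormedSpace.sphere_nonempty (E := EuclideanSpace ℝ (Fin (2 * n))) (x := 0).2
    zero_le_one
  ⟨_, (h ⟨s, hs⟩).2⟩

theorem exists_continuousMap_eq_stdSphere [T2Space W] [CompactSpace W]
    (h : BdrySphere n ≃ₜ manifoldBoundary (2 * n) W) :
    ∃ b : C(W, (ℕ → ℝ) × ℝ), ∀ s, b (h s) = stdSphere s := by
  have hclosed : IsClosedEmbedding fun s => (h s : W) :=
    (isClosed_manifoldBoundary (2 * n)).isClosedEmbedding_subtypeVal.comp h.isClosedEmbedding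
  obtain ⟨b, hb⟩ := ContinuousMap.exists_extension' hclosed ⟨stdSphere, continuous_stdSphere⟩
  exact ⟨b, congrFun hb⟩

variable {T : Type*} [TopologicalSpace T] {D : Set T} {f : T × W → (ℕ → ℝ) × ℝ}

theorem IsStableFamily.snd_nonneg (hf : IsStableFamily h D f) {t : T} (ht : t ∈ D) (w : W) :
    0 ≤ (f (t, w)).2 := by
  by_cases hw : w ∈ manifoldBoundary (2 * n) W
  · obtain ⟨s, rfl⟩ := exists_eq_of_mem_boundary h hw
    rw [hf.boundary t ht]
    exact le_rfl
  · exact (hf.pos t ht w hw).le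

theorem injective_of_eq_stdSphere {F : W → (ℕ → ℝ) × ℝ} {ι : W → Fin (m + 1) → ℝ}
    (hF : ∀ s, F (h s) = stdSphere s) (hFι : ∀ w w', F w = F w' → ι w = ι w')
    (hι_zero : ∀ w, ι w = 0 ↔ w ∈ manifoldBoundary (2 * n) W)
    (hι_inj : Set.InjOn ι (manifoldBoundary (2 * n) W)ᶜ) : Function.Injective F := by
  intro w w' hww'
  have hι := hFι w w' hww'
  have hbdry : w ∈ manifoldBoundary (2 * n) W ↔ w' ∈ manifoldBoundary (2 * n) W := by
    rw [← hι_zero, hι, hι_zero]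
  by_cases hw : w ∈ manifoldBoundary (2 * n) W
  · obtain ⟨s, rfl⟩ := exists_eq_of_mem_boundary h hw
    obtain ⟨s', rfl⟩ := exists_eq_of_mem_boundary h (hbdry.1 hw)
    rw [hF, hF] at hww'
    rw [stdSphere_injective hww']
  · exact hι_inj hw (hbdry.not.1 hw) hι

theorem IsStableFamily.exists_continuous_extension [T2Space W] [CompactSpace W] [CompactSpace T]
    [T2Space T] (hD : IsClosed D) (hf : IsStableFamily h D f) :
    ∃ g : C(T × W, (ℕ → ℝ) × ℝ), Set.EqOn g f (D ×ˢ Set.univ) ∧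
      ∀ t s, g (t, (h s : W)) = stdSphere s := by
  classical
  obtain ⟨b, hb⟩ := exists_continuousMap_eq_stdSphere h
  let g₀ : T × W → (ℕ → ℝ) × ℝ := fun p => if p.1 ∈ D then f p else b p.2
  have hg₀_D : Set.EqOn g₀ f (D ×ˢ Set.univ) := fun p hp => if_pos hp.1
  have hg₀_bdry : Set.EqOn g₀ (fun p => b p.2) (Set.univ ×ˢ manifoldBoundary (2 * n) W) := by
    rintro ⟨t, w⟩ ⟨-, hw⟩
    obtain ⟨s, rfl⟩ := exists_eq_of_mem_boundary h hw
    by_cases ht : t ∈ D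
    · rw [hg₀_D ⟨ht, trivial⟩, hf.boundary t ht]
      exact (hb s).symm
    · exact if_neg ht
  have hclosed_D : IsClosed (D ×ˢ (Set.univ : Set W)) := hD.prod isClosed_univ
  have hclosed_bdry : IsClosed ((Set.univ : Set T) ×ˢ manifoldBoundary (2 * n) W) :=
    isClosed_univ.prod (isClosed_manifoldBoundary _)
  have hg₀ : ContinuousOn g₀ (D ×ˢ Set.univ ∪ Set.univ ×ˢ manifoldBoundary (2 * n) W) :=
    (hf.continuousOn.congr hg₀_D).union_of_isClosed
      ((b.continuous.comp continuous_snd).continuousOn.congr hg₀_bdry) hclosed_D hclosed_bdry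
  obtain ⟨g, hg⟩ := ContinuousMap.exists_restrict_eq (hclosed_D.union hclosed_bdry)
    ⟨_, continuousOn_iff_continuous_domRestrict.1 hg₀⟩
  have hgg₀ : Set.EqOn g g₀ (D ×ˢ Set.univ ∪ Set.univ ×ˢ manifoldBoundary (2 * n) W) :=
    fun p hp => DFunLike.congr_fun hg ⟨p, hp⟩
  refine ⟨g, (hgg₀.mono Set.subset_union_left).trans hg₀_D, fun t s => ?_⟩
  have hs : (t, (h s : W)) ∈ (Set.univ : Set T) ×ˢ manifoldBoundary (2 * n) W := ⟨trivial, (h s).2⟩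
  exact (hgg₀ (Or.inr hs)).trans ((hg₀_bdry hs).trans (hb s))

/-- A Tietze extension `g` of the family need not be injective or positive off the zero set of `l`.
Both are achieved by adding `l • ι` in new coordinates, for an embedding `ι` of `W / ∂W`: it
vanishes exactly over that set and on `∂W`, where `g` is already as required. -/
theorem IsStableFamily.exists_extension [NeZero n] [T2Space W] [CompactSpace W]
    [ChartedSpace (EuclideanHalfSpace (2 * n)) W] [CompactSpace T] [T2Space T] {l : T → ℝ}
    (hl : Continuous l) (hl_nonneg : ∀ t, 0 ≤ l t) (hf : IsStableFamily h (l ⁻¹' {0}) f) :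
    ∃ F, IsStableFamily h Set.univ F ∧ Set.EqOn F f ((l ⁻¹' {0}) ×ˢ Set.univ) := by
  obtain ⟨g, hg_zero, hg_bdry⟩ :=
    hf.exists_continuous_extension (isClosed_singleton.preimage hl)
  obtain ⟨M, hM⟩ := hf.bounded
  obtain ⟨m, ι, hι_bdry, hι_pos, hι_inj⟩ :=
    exists_continuous_injOn_interior (nonempty_manifoldBoundary h)
  let F : T × W → (ℕ → ℝ) × ℝ := fun p => perturb (max M (2 * n)) (g p) (l p.1 • ι p.2)
  have hF_zero : Set.EqOn F f ((l ⁻¹' {0}) ×ˢ Set.univ) := by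
    rintro ⟨t, w⟩ ⟨ht, -⟩
    change perturb _ (g (t, w)) (l t • ι w) = f (t, w)
    rw [hg_zero ⟨ht, trivial⟩, show l t = 0 from ht, zero_smul]
    exact perturb_zero (fun i hi => hM t ht w i ((le_max_left _ _).trans hi)) (hf.snd_nonneg ht w)
  have hF_bdry (t : T) (s : BdrySphere n) : F (t, h s) = stdSphere s := by
    change perturb _ (g (t, h s)) (l t • ι (h s)) = stdSphere s
    rw [hg_bdry, hι_bdry _ (h s).2, smul_zero]
    exact perturb_zero (fun i hi => stabInf_fst_of_le _ ((le_max_right _ _).trans hi)) le_rfl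
  have hι_zero (w : W) : ι w = 0 ↔ w ∈ manifoldBoundary (2 * n) W :=
    ⟨fun hw => not_not.1 fun hw' => (hι_pos w hw').ne' (congrFun hw 0), hι_bdry w⟩
  refine ⟨F, ⟨?_, ⟨max M (2 * n) + (m + 1), fun _ _ _ _ hi => stabInf_fst_of_le _ hi⟩,
    fun t _ => ?_, fun t _ => hF_bdry t, fun t _ w hw => ?_⟩, hF_zero⟩
  · exact (continuous_perturb.comp (g.continuous.prodMk (by fun_prop))).continuousOn
  · by_cases ht : t ∈ l ⁻¹' {0}
    · have hfF : (fun w => F (t, w)) = fun w => f (t, w) := funext fun w => hF_zero ⟨ht, trivial⟩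
      exact hfF ▸ hf.injective t ht
    · exact injective_of_eq_stdSphere (hF_bdry t) (fun w w' hww' =>
        smul_right_injective _ ht (eq_of_perturb_eq hww')) hι_zero hι_inj
  · by_cases ht : t ∈ l ⁻¹' {0}
    · rw [hF_zero ⟨ht, trivial⟩]
      exact hf.pos t ht w hw
    · exact perturb_snd_pos _ (mul_pos ((hl_nonneg t).lt_of_ne' ht) (hι_pos w hw))

end Extension

/-! ### Filling boundaries of simplices -/

section Filling

variable {n : ℕ} {W : Type u} [TopologicalSpace W]
  {h : BdrySphere n ≃ₜ manifoldBoundary (2 * n) W}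

theorem exists_isStableFamily_iUnion {T α : Type*} [TopologicalSpace T] [Finite α]
    {C : α → Set T} (hC : ∀ a, IsClosed (C a)) {g : α → T × W → (ℕ → ℝ) × ℝ}
    (hg : ∀ a, IsStableFamily h Set.univ (g a))
    (hgg : ∀ a a' t w, t ∈ C a → t ∈ C a' → g a (t, w) = g a' (t, w)) :
    ∃ f, IsStableFamily h (⋃ a, C a) f ∧ ∀ a, ∀ t ∈ C a, ∀ w, f (t, w) = g a (t, w) := by
  classical
  have := Fintype.ofFinite α
  let f : T × W → (ℕ → ℝ) × ℝ := fun p => if hp : ∃ a, p.1 ∈ C a then g hp.choose p else 0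
  have hf (a : α) (t : T) (ht : t ∈ C a) (w : W) : f (t, w) = g a (t, w) := by
    have hp : ∃ a, t ∈ C a := ⟨a, ht⟩
    exact (dif_pos hp).trans (hgg _ _ _ _ hp.choose_spec ht)
  choose M hM using fun a => (hg a).bounded
  refine ⟨f, ⟨?_, ⟨Finset.univ.sup M, fun t ht w i hi => ?_⟩, fun t ht => ?_, fun t ht s => ?_,
    fun t ht w hw => ?_⟩, hf⟩
  · rw [Set.iUnion_prod_const]
    refine (locallyFinite_of_finite _).continuousOn_iUnion
      (fun a => (hC a).prod isClosed_univ) fun a => ?_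
    exact ((hg a).continuousOn.mono (Set.prod_mono_left (Set.subset_univ _))).congr
      fun p hp => hf a p.1 hp.1 p.2
  all_goals obtain ⟨a, ha⟩ := Set.mem_iUnion.1 ht
  · rw [hf a t ha]
    exact hM a t trivial w i ((Finset.le_sup (Finset.mem_univ a)).trans hi)
  · simp only [hf a t ha]
    exact (hg a).injective t trivial
  · rw [hf a t ha]
    exact (hg a).boundary t trivial s
  · rw [hf a t ha]
    exact (hg a).pos t trivial w hw

theorem simpMap_apply_eq_zero {j k : SimplexCategory} {θ : j ⟶ k} {i : Fin (k.len + 1)}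
    (hθ : ∀ a, θ a ≠ i) (t : Simp j) : simpMap θ t i = 0 := by
  have hsum := sum_stdSimplex_map_mul θ t (Pi.single i 1)
  simpa [Pi.single_apply, hθ] using hsum

variable {k : ℕ}

theorem iUnion_simpMap_fixed_eq :
    ⋃ θ : {θ : (⦋k⦌ : SimplexCategory) ⟶ ⦋k⦌ // ∃ i, ∀ a, θ a ≠ i}, {t | simpMap θ.1 t = t} =
      (fun t : Simp ⦋k⦌ => ∏ i, t i) ⁻¹' {0} := by
  ext t
  simp only [Set.mem_iUnion, Set.mem_ofPred_eq, Set.mem_preimage, Set.mem_singleton_iff,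
    Finset.prod_eq_zero_iff, Finset.mem_univ, true_and]
  constructor
  · rintro ⟨⟨θ, i, hi⟩, ht⟩
    exact ⟨i, ht ▸ simpMap_apply_eq_zero hi t⟩
  · rintro ⟨i, hi⟩
    obtain ⟨ρ, hρ, hρt⟩ := exists_orderHom_map_eq_self t
    exact ⟨⟨SimplexCategory.Hom.mk ρ, i, fun a ha => hρ a (ha ▸ hi)⟩, hρt⟩

theorem stable_map {j l : SimplexCategory} (θ : j ⟶ l) (x : (EmbInf h).obj (op l))
    (t : Simp j) (w : W) :
    EmbInfSimplex.stable (h := h) (k := j) ((EmbInf h).map θ.op x) (t, w) =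
      EmbInfSimplex.stable (h := h) (k := l) x (simpMap θ t, w) :=
  EmbInfSimplex.stable_pullback θ _ t w

variable (b : (∂Δ[k] : SSet.{u}) ⟶ EmbInf h)

/-- The stable family over a face of `Δ[k]` underlying a map from the boundary of `Δ[k]`. -/
def faceStable {m : SimplexCategory} (θ : m ⟶ ⦋k⦌) (hθ : ∃ i, ∀ a, θ a ≠ i) :
    Simp m × W → (ℕ → ℝ) × ℝ :=
  EmbInfSimplex.stable (h := h) (k := m) (b.app _ (bdrySimplex θ hθ))

theorem faceStable_comp {l m : SimplexCategory} (η : l ⟶ m) (θ : m ⟶ ⦋k⦌)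
    (hθ : ∃ i, ∀ a, θ a ≠ i) (hθ' : ∃ i, ∀ a, (η ≫ θ) a ≠ i) (t : Simp l) (w : W) :
    faceStable b (η ≫ θ) hθ' (t, w) = faceStable b θ hθ (simpMap η t, w) := by
  rw [faceStable, map_bdrySimplex η θ hθ hθ']
  exact stable_map η _ t w

theorem faceStable_eq_of_simpMap_eq {m : SimplexCategory} {θ θ' : m ⟶ ⦋k⦌}
    (hθ : ∃ i, ∀ a, θ a ≠ i) (hθ' : ∃ i, ∀ a, θ' a ≠ i) {t : Simp m}
    (ht : simpMap θ t = simpMap θ' t) (w : W) :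
    faceStable b θ hθ (t, w) = faceStable b θ' hθ' (t, w) := by
  obtain ⟨ρ, hρ, hρt⟩ := exists_orderHom_map_eq_self t
  let η : m ⟶ m := SimplexCategory.Hom.mk ρ
  have hηt : simpMap η t = t := hρt
  have hη : η ≫ θ = η ≫ θ' := by
    ext a : 3
    exact eq_of_stdSimplex_map_eq θ.toOrderHom.monotone θ'.toOrderHom.monotone ht (hρ a)
  have hmiss : ∃ i, ∀ a, (η ≫ θ) a ≠ i := hθ.imp fun i hi a => hi (η a)
  have hcomp : faceStable b (η ≫ θ) hmiss (t, w) = faceStable b (η ≫ θ') (hη ▸ hmiss) (t, w) := by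
    congr
  rwa [faceStable_comp, faceStable_comp, hηt] at hcomp

theorem exists_isStableFamily_eq_faceStable :
    ∃ f, IsStableFamily h ((fun t : Simp ⦋k⦌ => ∏ i, t i) ⁻¹' {0}) f ∧
      ∀ {m : SimplexCategory} (θ : m ⟶ ⦋k⦌) (hθ : ∃ i, ∀ a, θ a ≠ i) (t : Simp m) (w : W),
        f (simpMap θ t, w) = faceStable b θ hθ (t, w) := by
  obtain ⟨f, hf, hfb⟩ := exists_isStableFamily_iUnion (h := h)
    (C := fun θ : {θ : (⦋k⦌ : SimplexCategory) ⟶ ⦋k⦌ // ∃ i, ∀ a, θ a ≠ i} =>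
      {t | simpMap θ.1 t = t}) (g := fun θ => faceStable b θ.1 θ.2)
    (fun θ => isClosed_eq (stdSimplex.continuous_map θ.1) continuous_id)
    (fun θ => EmbInfSimplex.isStableFamily _)
    (fun θ θ' t w ht ht' => faceStable_eq_of_simpMap_eq b _ _ (ht.trans ht'.symm) w)
  rw [iUnion_simpMap_fixed_eq] at hf
  refine ⟨f, hf, fun θ hθ t w => ?_⟩
  obtain ⟨ρ, hρ, hρt⟩ := exists_orderHom_map_eq_self (simpMap θ t)
  obtain ⟨i, hi⟩ := hθ
  let η : (⦋k⦌ : SimplexCategory) ⟶ ⦋k⦌ := SimplexCategory.Hom.mk ρ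
  have hη : ∀ a, η a ≠ i := fun a ha => hρ a (ha ▸ simpMap_apply_eq_zero hi t)
  rw [hfb ⟨η, i, hη⟩ _ hρt, ← faceStable_comp b θ η _ ⟨i, fun a => hη (θ a)⟩]
  exact faceStable_eq_of_simpMap_eq b _ _ ((simpMap_comp θ η t).trans hρt) w

variable (h) in
theorem isTrivFib_EmbInf [NeZero n] [T2Space W] [CompactSpace W]
    [ChartedSpace (EuclideanHalfSpace (2 * n)) W] : IsTrivFib (toPt (EmbInf h)) := by
  refine isTrivFib_toPt_of_exists_extension fun k b => ?_
  obtain ⟨f, hf, hfb⟩ := exists_isStableFamily_eq_faceStable b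
  obtain ⟨F, hF, hFf⟩ := hf.exists_extension (by fun_prop)
    fun t => Finset.prod_nonneg fun i _ => t.2.1 i
  obtain ⟨x, rfl⟩ := hF.exists_stable_eq
  refine ⟨x, fun {m} θ hθ => EmbInfSimplex.stable_injective (h := h) (k := m) ?_⟩
  funext ⟨t, w⟩
  obtain ⟨i, hi⟩ := hθ
  have ht : simpMap θ t ∈ (fun t : Simp ⦋k⦌ => ∏ i, t i) ⁻¹' {0} :=
    Finset.prod_eq_zero (Finset.mem_univ i) (simpMap_apply_eq_zero hi t)
  exact (stable_map θ _ t w).trans ((hFf ⟨ht, trivial⟩).trans (hfb θ _ t w))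

end Filling

end LFEmb

end

theorem mainTheorem9_general {n : ℕ} [NeZero n] {W : Type u} [TopologicalSpace W] [T2Space W]
    [CompactSpace W] [ChartedSpace (EuclideanHalfSpace (2 * n)) W]
    (h : LFEmb.BdrySphere n ≃ₜ LFEmb.manifoldBoundary (2 * n) W) :
    LFEmb.IsWeaklyContractible (LFEmb.EmbInf h) ∧
    LFEmb.IsLevelwiseFree (LFEmb.TopBdry (2 * n) W) (LFEmb.EmbInf h) ∧
    ∃ (F : LFEmb.EmbInf h ⟶ LFEmb.EG (LFEmb.TopBdry (2 * n) W))
      (hF : LFEmb.IsEquivariant (LFEmb.TopBdry (2 * n) W) F),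
      LFEmb.IsRealizationEquiv (X := LFEmb.orbitSpace (LFEmb.TopBdry (2 * n) W) (LFEmb.EmbInf h))
        (Y := LFEmb.BG (LFEmb.TopBdry (2 * n) W))
        (LFEmb.orbitMap (LFEmb.TopBdry (2 * n) W) F hF) := by
  have hfree := LFEmb.isLevelwiseFree_EmbInf h
  have hX := LFEmb.isTrivFib_EmbInf h
  exact ⟨LFEmb.isWeaklyContractible_of_isTrivFib hX, hfree, LFEmb.exists_classifyingMap hfree hX⟩

theorem mainTheorem9 {n : ℕ} [NeZero n] {W : Type u} [TopologicalSpace W] [T2Space W]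
    [CompactSpace W] [ChartedSpace (EuclideanHalfSpace (2 * n)) W] [SimplyConnectedSpace W]
    (h : LFEmb.BdrySphere n ≃ₜ LFEmb.manifoldBoundary (2 * n) W) :
    LFEmb.IsWeaklyContractible (LFEmb.EmbInf h) ∧
    LFEmb.IsLevelwiseFree (LFEmb.TopBdry (2 * n) W) (LFEmb.EmbInf h) ∧
    ∃ (F : LFEmb.EmbInf h ⟶ LFEmb.EG (LFEmb.TopBdry (2 * n) W))
      (hF : LFEmb.IsEquivariant (LFEmb.TopBdry (2 * n) W) F),
      LFEmb.IsRealizationEquiv (X := LFEmb.orbitSpace (LFEmb.TopBdry (2 * n) W) (LFEmb.EmbInf h))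
        (Y := LFEmb.BG (LFEmb.TopBdry (2 * n) W))
        (LFEmb.orbitMap (LFEmb.TopBdry (2 * n) W) F hF) := by
  exact mainTheorem9_general h
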